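/- Let $A=\{a_1,\dots,a_r\}$ be a finite alphabet, $\tilde A=A\cup A^{-1}$, and let $\mu\colon F(A)\to G$ be an epimorphism onto a group $G$; write $\bar w\in G$ for the element represented by a word $w\in\tilde A^*$, and $d(g,h)$ for the length of a shortest word representing $g^{-1}h$. Let $L\subseteq\tilde A^*$ be the rational structure of an automatic structure on $G$: $L$ is a rational language of reduced words with $\{\bar w : w\in L\}=G$, and for each $a\in\tilde A\cup\{1\}$ the set of pairs $(u,v)\in L\times L$ with $\overline{ua}=\bar v$ is recognized by a finite automaton reading both words synchronously, the shorter one padded at its end. For a subgroup $H\le G$, an integer $k\ge 0$ is a constant of $L$-quasi-convexity of $H$ if, for every $w\in L$ with $\bar w\in H$ and every prefix $u$ of $w$, there is $h\in H$ with $d(h,\bar u)\le k$; $H$ is $L$-quasi-convex if such a $k$ exists. The Stallings graph $\Gamma_L(H)$ is the subgraph, rooted at $H$, of the Schreier graph of $H$ (vertices the cosets $Hg$, edges $Hg\xrightarrow{a}Hg\bar a$ for $g\in G$, $a\in A$) formed by the vertices and edges visited by the loops at the vertex $H$ labeled by the words $w\in L$ with $\bar w\in H$. The group $G$, with $\mu$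 and its automatic structure, is fixed. Then: 1. There is an algorithm which, given words $h_1,\dots,h_s$ such that $H=\langle\bar h_1,\dots,\bar h_s\rangle$ is $L$-quasi-convex, computes $\Gamma_L(H)$, that is, outputs an explicit finite rooted $A$-labeled graph isomorphic to $\Gamma_L(H)$. 2. There is an algorithm which, given words $h_1,\dots,h_s$ as in 1 and a word $w$, decides whether $\bar w\in H$. Moreover, the membership problem is decidable for every $L$-quasi-convex subgroup of $G$. 3. There is an algorithm which, given words $h_1,\dots,h_s$ as in 1, computes the least constant of $L$-quasi-convexity of $H$. In 1, 2 and 3 it is only required that the algorithm halts with a correct answer on inputs for which $H$ is $L$-quasi-convex; no constant of $L$-quasi-convexity is part of the input. -/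

import Mathlib

/-! ### Words and their values in an `A`-generated group -/

/-- The alphabet `Ã`: the letter `(a, true)` is `a` and `(a, false)` is its formal inverse. -/
abbrev Letter (A : Type*) := A × Bool

/-- The words over `Ã`. -/
abbrev Word (A : Type*) := List (Letter A)

section Groups

variable {A G : Type*} [Group G]

/-- The element of `G` represented by a word, for a choice of generators `μ : F(A) → G`. -/
def wordVal (μ : FreeGroup A →* G) (w : Word A) : G := μ (FreeGroup.mk w)

/-- The length `|g|` of a shortest word representing `g`. -/
noncomputable def wordLength (μ : FreeGroup A →* G) (g : G) : ℕ :=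
  sInf {n | ∃ w : Word A, w.length = n ∧ wordVal μ w = g}

/-- The word metric `d(g, h) = |g⁻¹ h|`, that is, the distance in the Cayley graph. -/
noncomputable def wordDist (μ : FreeGroup A →* G) (g h : G) : ℕ := wordLength μ (g⁻¹ * h)

/-- The subgroup of `G` generated by the values of a finite list of words. -/
def subgroupOf (μ : FreeGroup A →* G) (hs : List (Word A)) : Subgroup G :=
  Subgroup.closure {g | ∃ h ∈ hs, wordVal μ h = g}

/-! ### Rational and automatic structures -/

/-- `(G, L)` is a rational structure: `L` is accepted by a finite automaton, consists of
reduced words, and represents every element of `G`. -/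
structure IsRationalStructure (μ : FreeGroup A →* G) (L : Language (Letter A)) : Prop where
  regular : L.IsRegular
  reduced : ∀ w ∈ L, FreeGroup.IsReduced w
  surj : ∀ g : G, ∃ w ∈ L, wordVal μ w = g

/-- The word over `(Ã ∪ {□})²` encoding the pair `(u, v)`: the shorter of the two words is padded
at its end with copies of `□ = none`. -/
def padPair {α : Type*} (u v : List α) : List (Option α × Option α) :=
  List.zipWithAll Prod.mk u v

/-- A set of pairs of words is accepted by a finite automaton (reading padded pairs). -/
def IsRegularRel {α : Type*} (R : List α → List α → Prop) : Prop :=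
  Language.IsRegular ({x | ∃ u v, R u v ∧ x = padPair u v} : Language (Option α × Option α))

/-- `L` is the language of an automatic structure for `G`: it gives a rational structure (word
acceptor), and for every `a ∈ Ã ∪ {1}` (where `1` is `none`) the pairs `(u, v) ∈ L × L` such that
`u a` and `v` have the same value are accepted by a finite automaton (multiplier). -/
structure IsAutomaticStructure (μ : FreeGroup A →* G) (L : Language (Letter A)) : Prop where
  rational : IsRationalStructure μ L
  multiplier : ∀ a : Option (Letter A),
    IsRegularRel fun u v => u ∈ L ∧ v ∈ L ∧ wordVal μ (u ++ a.toList) = wordVal μ v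

/-! ### Quasi-convexity -/

/-- `k` is a constant of `L`-quasi-convexity of `S`: every path from `1` in the Cayley graph
labeled by a word of `L` with value in `S` stays within distance at most `k` from `S`. -/
def IsQuasiConvexConst (μ : FreeGroup A →* G) (L : Language (Letter A)) (S : Set G) (k : ℕ) :
    Prop :=
  ∀ w ∈ L, wordVal μ w ∈ S → ∀ u, u <+: w → ∃ s ∈ S, wordDist μ s (wordVal μ u) ≤ k

def IsQuasiConvex (μ : FreeGroup A →* G) (L : Language (Letter A)) (S : Set G) : Prop :=
  ∃ k, IsQuasiConvexConst μ L S k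

end Groups

/-! ### Rooted `A`-graphs -/

/-- A rooted directed graph with edges labeled by `A`; there is at most one `a`-labeled edge from a
given vertex to another given vertex. -/
structure RootedGraph (A V : Type*) where
  verts : Set V
  edge : V → A → V → Prop
  edge_src : ∀ {p a q}, edge p a q → p ∈ verts
  edge_tgt : ∀ {p a q}, edge p a q → q ∈ verts
  root : V
  root_mem : root ∈ verts

namespace RootedGraph

variable {A V V' : Type*}

/-- Reading a letter: `a` is read along an `a`-labeled edge, and `a⁻¹` against one. -/
def Step (Γ : RootedGraph A V) (p : V) (x : Letter A) (q : V) : Prop :=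
  (x.2 = true ∧ Γ.edge p x.1 q) ∨ (x.2 = false ∧ Γ.edge q x.1 p)

/-- The word `w` labels a path from `p` to `q`. -/
def Reads (Γ : RootedGraph A V) : V → Word A → V → Prop
  | p, [], q => p = q
  | p, x :: w, q => ∃ m, Γ.Step p x m ∧ Γ.Reads m w q

theorem reads_append_singleton (Γ : RootedGraph A V) {x : Letter A} {q q' : V} :
    ∀ {u : Word A} {p : V}, Γ.Reads p u q → Γ.Step q x q' → Γ.Reads p (u ++ [x]) q'
  | [], _, h, hx => by
      cases h
      exact ⟨q', hx, rfl⟩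
  | _ :: _, _, ⟨m, hm, h⟩, hx => ⟨m, hm, reads_append_singleton Γ h hx⟩

/-- The subgraph spanned by the loops at the root labeled by the words of `W`: its vertices and
edges are those (together with the root) that are visited by such loops. -/
def spannedByLoops (Γ : RootedGraph A V) (W : Set (Word A)) : RootedGraph A V where
  verts := {p | p = Γ.root ∨
    ∃ u v, u ++ v ∈ W ∧ Γ.Reads Γ.root u p ∧ Γ.Reads p v Γ.root}
  edge p a q := Γ.edge p a q ∧ ∃ u v,
    (u ++ (a, true) :: v ∈ W ∧ Γ.Reads Γ.root u p ∧ Γ.Reads q v Γ.root) ∨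
    (u ++ (a, false) :: v ∈ W ∧ Γ.Reads Γ.root u q ∧ Γ.Reads p v Γ.root)
  edge_src := by
    rintro p a q ⟨he, u, v, ⟨hw, h1, h2⟩ | ⟨hw, h1, h2⟩⟩
    · exact Or.inr ⟨u, (a, true) :: v, hw, h1, q, Or.inl ⟨rfl, he⟩, h2⟩
    · exact Or.inr ⟨u ++ [(a, false)], v, by simpa using hw,
        Γ.reads_append_singleton h1 (Or.inr ⟨rfl, he⟩), h2⟩
  edge_tgt := by
    rintro p a q ⟨he, u, v, ⟨hw, h1, h2⟩ | ⟨hw, h1, h2⟩⟩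
    · exact Or.inr ⟨u ++ [(a, true)], v, by simpa using hw,
        Γ.reads_append_singleton h1 (Or.inl ⟨rfl, he⟩), h2⟩
    · exact Or.inr ⟨u, (a, false) :: v, hw, h1, p, Or.inr ⟨rfl, he⟩, h2⟩
  root := Γ.root
  root_mem := Or.inl rfl

/-- Isomorphism of rooted labeled graphs. -/
def Iso (Γ : RootedGraph A V) (Δ : RootedGraph A V') : Prop :=
  ∃ φ : Γ.verts ≃ Δ.verts, φ ⟨Γ.root, Γ.root_mem⟩ = ⟨Δ.root, Δ.root_mem⟩ ∧
    ∀ (p q : Γ.verts) (a : A), Γ.edge p a q ↔ Δ.edge (φ p) a (φ q)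

end RootedGraph

/-- Explicit descriptions of finite rooted graphs: `(n, E)` describes the graph with the vertices
`0, …, n`, the root `0`, and the edges listed in `E`. -/
abbrev GraphCode (r : ℕ) := ℕ × List (ℕ × Fin r × ℕ)

/-- The finite rooted graph described by a code. -/
def GraphCode.graph {r : ℕ} (c : GraphCode r) : RootedGraph (Fin r) ℕ where
  verts := {i | i ≤ c.1}
  edge i a j := (i, a, j) ∈ c.2 ∧ i ≤ c.1 ∧ j ≤ c.1
  edge_src h := h.2.1
  edge_tgt h := h.2.2
  root := 0
  root_mem := Nat.zero_le _

/-! ### Schreier graphs and Stallings graphs -/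

section Stallings

variable {A G : Type*} [Group G]

/-- The right coset `H g`. -/
def rightCoset (H : Subgroup G) (g : G) : Quotient (QuotientGroup.rightRel H) :=
  Quotient.mk _ g

/-- The Schreier graph: its vertices are the right cosets of `H`, rooted at `H`, with edges
`(H g, a, H g ā)`. -/
def schreierGraph (μ : FreeGroup A →* G) (H : Subgroup G) :
    RootedGraph A (Quotient (QuotientGroup.rightRel H)) where
  verts := Set.univ
  edge p a q := ∃ g : G, p = rightCoset H g ∧ q = rightCoset H (g * μ (FreeGroup.of a))
  edge_src _ := Set.mem_univ _
  edge_tgt _ := Set.mem_univ _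
  root := rightCoset H 1
  root_mem := Set.mem_univ _

/-- The Stallings graph `Γ_L(H)`: the fragment of the Schreier graph spanned by the loops at `H`
labeled by the `L`-representatives of the elements of `H`. -/
def stallingsGraph (μ : FreeGroup A →* G) (L : Language (Letter A)) (H : Subgroup G) :
    RootedGraph A (Quotient (QuotientGroup.rightRel H)) :=
  (schreierGraph μ H).spannedByLoops {w | w ∈ L ∧ wordVal μ w ∈ H}

end Stallings

/-!
Every algorithm of the theorem is an unbounded search for a finite certificate, so that only two
things matter: that correctness of a certificate is semidecidable, and that a certificate exists as
soon as the subgroup `H` is quasi-convex. Semidecidable predicates are handled in the form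
"`∃ n, R a n` with `R` primitive recursive" (`SigmaOne`); they are closed under conjunction,
disjunction, existential quantifiers and quantifiers over the members of a list, and
`SigmaOne.exists_partrec` turns them into searches.

The multipliers give the basic semidecidable facts. Following a word letter by letter through the
multipliers yields its representatives in `L` (`IsAutomaticStructure.sigmaOne_rep`), hence the word
problem and membership in a finitely generated subgroup are semidecidable. Moreover, for finite
tables `T₁`, `T₂` describing partial deterministic graphs, it is semidecidable whether
multiplication by a generator takes the words of `L` read by `T₁` from the root to `p` to words read
by `T₂` from the root to `q` (`IsAutomaticStructure.sigmaOne_closed`): this is a safety property of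
a product of finite automata, and a finite invariant witnesses it.

The main certificate (`IsCertificate`) for `H = ⟨h₁, …, hₛ⟩` is a finite part `E` of the Schreier
graph. The language `K` of the words of `L` that label loops of `E` at the root consists of
representatives of elements of `H`. If it contains a representative of `1` and is closed under
multiplication by the `hᵢ` and their inverses, then it consists of all of them
(`IsCertificate.recognizes`). Closure under `hᵢ` is certified one letter at a time, along a path
of vertices of `E`. If `H` is quasi-convex, then such a certificate exists: by the fellow traveller
property the words of `L` that end near `H` stay near `H`, so that a sufficiently large ball of the
Schreier graph reads all of them (`IsQuasiConvex.exists_table`,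
`IsQuasiConvex.exists_isCertificate`).

A certificate makes non-membership in `H` semidecidable as well (`HasNotMemWitness`): represent the
element in `L`, and read this word in `E`. It also makes it semidecidable whether a given table
reads all words of `L` with value in `H` as loops (`HasLoopsWitness`). Membership, the least
constant of quasi-convexity and the Stallings graph are then found by searching for an answer
together with witnesses for its correctness. For the Stallings graph (`IsStallingsCode`) these are
words that represent the vertices, witnesses that their cosets are distinct, words of `L` that
traverse the edges, and a witness that the edges suffice to read all words of `L` with value in `H`.
-/

/-! ### Semidecidable predicates -/

section Semidecidable

variable {α β γ B S : Type*} [Primcodable α] [Primcodable β] [Primcodable γ] [Primcodable S]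

attribute [local fun_prop] Primrec
attribute [local fun_prop] Primrec.id Primrec.const Primrec.comp Primrec.pair Primrec.fst Primrec.snd

/-- A semidecidable predicate, in Kleene normal form: one unbounded number quantifier in front of a
primitive recursive relation. The number codes everything that has to be searched for. -/
def SigmaOne (p : α → Prop) : Prop :=
  ∃ R : α → ℕ → Prop, PrimrecRel R ∧ ∀ a, p a ↔ ∃ n, R a n

theorem PrimrecPred.sigmaOne {p : α → Prop} (hp : PrimrecPred p) : SigmaOne p :=
  ⟨fun a _ => p a, hp.comp Primrec.fst, fun _ => ⟨fun h => ⟨0, h⟩, fun ⟨_, h⟩ => h⟩⟩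

namespace SigmaOne

theorem of_iff {p q : α → Prop} (hp : SigmaOne p) (h : ∀ a, q a ↔ p a) : SigmaOne q := by
  obtain ⟨R, hR, hp⟩ := hp
  exact ⟨R, hR, fun a => (h a).trans (hp a)⟩

theorem comp {p : β → Prop} {f : α → β} (hp : SigmaOne p) (hf : Primrec f) :
    SigmaOne fun a => p (f a) := by
  obtain ⟨R, hR, hp⟩ := hp
  exact ⟨fun a n => R (f a) n, hR.comp (hf.comp Primrec.fst) Primrec.snd, fun a => hp (f a)⟩

theorem and {p q : α → Prop} (hp : SigmaOne p) (hq : SigmaOne q) :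
    SigmaOne fun a => p a ∧ q a := by
  obtain ⟨R, hR, hp⟩ := hp
  obtain ⟨R', hR', hq⟩ := hq
  refine ⟨fun a n => R a n.unpair.1 ∧ R' a n.unpair.2,
    PrimrecPred.and (hR.comp Primrec.fst (Primrec.fst.comp (Primrec.unpair.comp Primrec.snd)))
      (hR'.comp Primrec.fst (Primrec.snd.comp (Primrec.unpair.comp Primrec.snd))), fun a => ?_⟩
  simp only [hp, hq]
  constructor
  · rintro ⟨⟨m, hm⟩, n, hn⟩
    exact ⟨Nat.pair m n, by simpa using ⟨hm, hn⟩⟩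
  · rintro ⟨n, h, h'⟩
    exact ⟨⟨_, h⟩, _, h'⟩

theorem or {p q : α → Prop} (hp : SigmaOne p) (hq : SigmaOne q) :
    SigmaOne fun a => p a ∨ q a := by
  obtain ⟨R, hR, hp⟩ := hp
  obtain ⟨R', hR', hq⟩ := hq
  refine ⟨fun a n => R a n ∨ R' a n, PrimrecPred.or hR hR', fun a => ?_⟩
  simp only [hp, hq, exists_or]

theorem ex {p : α → β → Prop} (hp : SigmaOne fun x : α × β => p x.1 x.2) :
    SigmaOne fun a => ∃ b, p a b := by
  obtain ⟨R, hR, hp⟩ := hp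
  have hdec : Primrec fun x : α × ℕ => Encodable.decode (α := β) x.2.unpair.1 :=
    Primrec.decode.comp (Primrec.fst.comp (Primrec.unpair.comp Primrec.snd))
  have hR' : PrimrecRel fun (b : β) (x : α × ℕ) => R (x.1, b) x.2.unpair.2 :=
    hR.comp (by fun_prop)
      (Primrec.snd.comp (Primrec.unpair.comp (Primrec.snd.comp Primrec.snd)))
  refine ⟨fun a n => ∃ b ∈ (Encodable.decode (α := β) n.unpair.1).toList, R (a, b) n.unpair.2,
    (hR'.exists_mem_list.comp (Primrec.optionToList.comp hdec) Primrec.id : PrimrecPred _),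
    fun a => ?_⟩
  constructor
  · rintro ⟨b, hb⟩
    obtain ⟨n, hn⟩ := (hp (a, b)).1 hb
    exact ⟨Nat.pair (Encodable.encode b) n, b, by simp, by simpa using hn⟩
  · rintro ⟨n, b, -, hn⟩
    exact ⟨b, (hp (a, b)).2 ⟨_, hn⟩⟩

/-- Bounded quantifiers: the witnesses for the members of a list have a common bound. -/
theorem forall_mem {p : α → β → Prop} {f : α → List β}
    (hp : SigmaOne fun x : α × β => p x.1 x.2) (hf : Primrec f) :
    SigmaOne fun a => ∀ b ∈ f a, p a b := by
  obtain ⟨R, hR, hp⟩ := hp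
  have h1 : PrimrecRel fun (n : ℕ) (x : β × α × ℕ) => R (x.2.1, x.1) n :=
    hR.comp (by fun_prop) (by fun_prop)
  have h2 : PrimrecRel fun (b : β) (x : α × ℕ) => ∃ n ∈ List.range x.2, R (x.1, b) n :=
    h1.exists_mem_list.comp (Primrec.list_range.comp (by fun_prop)) Primrec.id
  refine ⟨fun a N => ∀ b ∈ f a, ∃ n ∈ List.range N, R (a, b) n,
    (h2.forall_mem_list.comp (hf.comp Primrec.fst) Primrec.id : PrimrecPred _), fun a => ?_⟩
  simp only [List.mem_range]
  constructor
  · intro h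
    choose! n hn using fun b hb => (hp (a, b)).1 (h b hb)
    refine ⟨((f a).map n).sum + 1, fun b hb => ⟨n b, Nat.lt_succ_of_le ?_, hn b hb⟩⟩
    exact List.single_le_sum (by simp) _ (List.mem_map_of_mem hb)
  · rintro ⟨N, hN⟩ b hb
    obtain ⟨n, -, hn⟩ := hN b hb
    exact (hp (a, b)).2 ⟨n, hn⟩

theorem eq {f g : α → β} (hf : Primrec f) (hg : Primrec g) : SigmaOne fun a => f a = g a :=
  (Primrec.eq.comp hf hg : PrimrecPred _).sigmaOne

theorem ne {f g : α → β} (hf : Primrec f) (hg : Primrec g) : SigmaOne fun a => f a ≠ g a :=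
  (Primrec.eq.comp hf hg : PrimrecPred _).not.sigmaOne

theorem le {f g : α → ℕ} (hf : Primrec f) (hg : Primrec g) : SigmaOne fun a => f a ≤ g a :=
  (Primrec.nat_le.comp hf hg : PrimrecPred _).sigmaOne

theorem mem {f : α → β} {g : α → List β} (hf : Primrec f) (hg : Primrec g) :
    SigmaOne fun a => f a ∈ g a := by
  refine (Primrec.eq (α := β)).exists_mem_list.comp hg hf |>.sigmaOne.of_iff fun a => ?_
  simp

/-- Unbounded search for a witness of a semidecidable relation. -/
theorem exists_partrec {p : α → β → Prop} (hp : SigmaOne fun x : α × β => p x.1 x.2) :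
    ∃ f : α →. β, Partrec f ∧ (∀ a, ∀ b ∈ f a, p a b) ∧ ∀ a, (∃ b, p a b) → (f a).Dom := by
  classical
  obtain ⟨R, hR, hp⟩ := hp
  have hR' : PrimrecRel fun (x : α × ℕ) (b : β) => R (x.1, b) x.2.unpair.2 :=
    hR.comp (by fun_prop)
      (Primrec.snd.comp (Primrec.unpair.comp (Primrec.snd.comp Primrec.fst)))
  have hdec : Primrec fun x : α × ℕ => Encodable.decode (α := β) x.2.unpair.1 :=
    Primrec.decode.comp (Primrec.fst.comp (Primrec.unpair.comp Primrec.snd))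
  have hg : Primrec₂ fun (x : α × ℕ) (b : β) =>
      Option.guard (fun b => decide (R (x.1, b) x.2.unpair.2)) b :=
    Primrec.option_guard (p := fun (y : (α × ℕ) × β) (b : β) => R (y.1.1, b) y.1.2.unpair.2)
      (hR'.comp (by fun_prop) (by fun_prop)) Primrec.snd
  have hF : Primrec₂ fun (a : α) (n : ℕ) => (Encodable.decode (α := β) n.unpair.1).bind
      (Option.guard fun b => decide (R (a, b) n.unpair.2)) := Primrec.option_bind hdec hg
  refine ⟨_, Partrec.rfindOpt hF.to_comp, fun a b hb => ?_, fun a ⟨b, hb⟩ => ?_⟩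
  · obtain ⟨n, hn⟩ := Nat.rfindOpt_spec hb
    simp only [Option.mem_def, Option.bind_eq_some_iff, Option.guard_eq_some_iff,
      decide_eq_true_eq] at hn
    obtain ⟨b', -, rfl, h⟩ := hn
    exact (hp (a, b')).2 ⟨_, h⟩
  · obtain ⟨n, hn⟩ := (hp (a, b)).1 hb
    refine Nat.rfindOpt_dom.2 ⟨Nat.pair (Encodable.encode b) n, b, ?_⟩
    simpa [Option.bind_eq_some_iff, Option.guard_eq_some_iff] using hn

theorem rePred {p : α → Prop} (hp : SigmaOne p) : REPred p := by
  obtain ⟨f, hf, h1, h2⟩ := exists_partrec (p := fun a (_ : Unit) => p a) (hp.comp Primrec.fst)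
  exact hf.dom_re.of_eq fun a => ⟨fun h => h1 a _ (Part.get_mem h), fun h => h2 a ⟨(), h⟩⟩

/-- A safety property of a machine all of whose computations stay in a finite set is semidecidable:
it is witnessed by a finite set of configurations that contains the initial one and is closed under
the transitions. -/
theorem forall_foldl [Primcodable B] [Finite B] {init : α → S} {step : α → S → B → S}
    {P : α → S → Prop} (hinit : Primrec init)
    (hstep : Primrec fun x : α × S × B => step x.1 x.2.1 x.2.2)
    (hP : SigmaOne fun x : α × S => P x.1 x.2)
    (hfin : ∀ a, (Set.range fun z : List B => z.foldl (step a) (init a)).Finite) :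
    SigmaOne fun a => ∀ z : List B, P a (z.foldl (step a) (init a)) := by
  classical
  obtain ⟨l, hl⟩ : ∃ l : List B, ∀ b, b ∈ l := by
    have := Fintype.ofFinite B
    exact ⟨Finset.univ.toList, by simp⟩
  have key : SigmaOne fun a => ∃ I : List S, init a ∈ I ∧
      (∀ s ∈ I, P a s ∧ ∀ b ∈ l, step a s b ∈ I) := by
    refine .ex (.and (.mem (by fun_prop) (by fun_prop))
      (.forall_mem (.and (hP.comp (f := fun x : (α × List S) × S => (x.1.1, x.2)) (by fun_prop))
        (.forall_mem (.mem ?_ ?_) (by fun_prop))) (by fun_prop)))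
    · exact hstep.comp (g := fun x : ((α × List S) × S) × B => (x.1.1.1, x.1.2, x.2)) (by fun_prop)
    · fun_prop
  refine key.of_iff fun a => ⟨fun h => ⟨(hfin a).toFinset.toList, ?_, ?_⟩, ?_⟩
  · simpa using ⟨[], rfl⟩
  · simp only [Finset.mem_toList, Set.Finite.mem_toFinset, Set.mem_range]
    rintro _ ⟨z, rfl⟩
    exact ⟨h z, fun b _ => ⟨z ++ [b], by simp⟩⟩
  · rintro ⟨I, h0, hI⟩ z
    suffices ∀ s ∈ I, z.foldl (step a) s ∈ I from (hI _ (this _ h0)).1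
    induction z with
    | nil => exact fun s hs => hs
    | cons b z ih => exact fun s hs => ih _ ((hI s hs).2 b (hl b))

end SigmaOne

end Semidecidable

/-! ### Finite transition tables -/

/-- A finite transition table: the entry `((p, b), q)` says that the letter `b` leads from `p` to
`q`. The first entry for `(p, b)` counts. -/
abbrev Table (V B : Type*) := List ((V × B) × V)

/-- The value of the first entry with a given key. -/
def findKey {K V : Type*} [DecidableEq K] (T : List (K × V)) (k : K) : Option V := T.lookup k

theorem mem_of_findKey {K V : Type*} [DecidableEq K] {T : List (K × V)} {k : K} {v : V}
    (h : findKey T k = some v) : (k, v) ∈ T := by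
  obtain ⟨l₁, l₂, rfl, -⟩ := List.lookup_eq_some_iff.1 h
  simp

theorem findKey_ne_none {K V : Type*} [DecidableEq K] {T : List (K × V)} {k : K} {v : V}
    (h : (k, v) ∈ T) : findKey T k ≠ none := fun hn => by
  simpa using List.lookup_eq_none_iff.1 hn _ h

namespace Table

variable {V B X : Type*}

/-- The table of a transition function `δ`, restricted to the finite set `F` of transitions. The
states are named by `ρ`. -/
def IsTableOf (T : Table V B) (δ : X → B → X) (ρ : X → V) (F : Set (X × B)) : Prop :=
  ∀ p b q, ((p, b), q) ∈ T ↔ ∃ x, (x, b) ∈ F ∧ p = ρ x ∧ q = ρ (δ x b)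

theorem exists_isTableOf (δ : X → B → X) (ρ : X → V) {F : Set (X × B)} (hF : F.Finite) :
    ∃ T : Table V B, T.IsTableOf δ ρ F := by
  refine ⟨hF.toFinset.toList.map fun y => ((ρ y.1, y.2), ρ (δ y.1 y.2)), fun p b q => ?_⟩
  simp only [List.mem_map, Finset.mem_toList, Set.Finite.mem_toFinset, Prod.exists, Prod.mk.injEq]
  constructor
  · rintro ⟨x, b, h, ⟨rfl, rfl⟩, rfl⟩
    exact ⟨x, h, rfl, rfl⟩
  · rintro ⟨x, h, rfl, rfl⟩
    exact ⟨x, b, h, ⟨rfl, rfl⟩, rfl⟩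

section Run

variable [DecidableEq V] [DecidableEq B]

/-- One transition; `none` stands for being stuck. -/
def move (T : Table V B) (o : Option V) (b : B) : Option V :=
  o.bind fun p => findKey T (p, b)

/-- The vertex reached by reading a word. -/
def run (T : Table V B) (o : Option V) (w : List B) : Option V := w.foldl T.move o

@[simp] theorem run_nil (T : Table V B) (o : Option V) : T.run o [] = o := rfl

theorem run_cons (T : Table V B) (o : Option V) (b : B) (w : List B) :
    T.run o (b :: w) = T.run (T.move o b) w := rfl

theorem run_append (T : Table V B) (o : Option V) (u v : List B) :
    T.run o (u ++ v) = T.run (T.run o u) v := List.foldl_append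

@[simp] theorem run_none (T : Table V B) (w : List B) : T.run none w = none := by
  induction w with
  | nil => rfl
  | cons b w ih => exact ih

theorem mem_of_move {T : Table V B} {p q : V} {b : B} (h : T.move (some p) b = some q) :
    ((p, b), q) ∈ T :=
  mem_of_findKey h

theorem exists_run_of_run_append {T : Table V B} {p q : V} {u v : List B}
    (h : T.run (some p) (u ++ v) = some q) :
    ∃ m, T.run (some p) u = some m ∧ T.run (some m) v = some q := by
  rw [run_append] at h
  cases hm : T.run (some p) u with
  | none => simp [hm] at h
  | some m => exact ⟨m, rfl, by rw [← hm, h]⟩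

theorem exists_move_of_run_cons {T : Table V B} {p q : V} {b : B} {v : List B}
    (h : T.run (some p) (b :: v) = some q) :
    ∃ m, T.move (some p) b = some m ∧ T.run (some m) v = some q := by
  obtain ⟨m, h1, h2⟩ := exists_run_of_run_append (u := [b]) h
  exact ⟨m, h1, h2⟩

/-- A relation between vertices and states that is preserved by every entry of the table is
preserved along runs. -/
theorem run_invariant {T : Table V B} {δ : X → B → X} {I : V → X → Prop}
    (hT : ∀ p b q x, ((p, b), q) ∈ T → I p x → I q (δ x b)) :
    ∀ {w : List B} {p q : V} {x : X}, T.run (some p) w = some q → I p x → I q (w.foldl δ x)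
  | [], _, _, _, h, hx => by
      obtain rfl := Option.some.inj h
      exact hx
  | _ :: _, _, _, _, h, hx => by
      obtain ⟨m, h1, h2⟩ := exists_move_of_run_cons h
      rw [List.foldl_cons]
      exact run_invariant hT h2 (hT _ _ _ _ (mem_of_move h1) hx)

/-- Runs of a table stay in the finite set of the entries' targets. -/
theorem finite_range_run (T : Table V B) (p : V) : (Set.range (T.run (some p))).Finite := by
  refine (((T.map fun e => some e.2).toFinset ∪ {none, some p}).finite_toSet).subset ?_
  rintro _ ⟨w, rfl⟩
  induction w using List.reverseRecOn with
  | nil => simp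
  | append_singleton w b _ =>
    rw [run_append]
    cases hm : T.run (some p) w with
    | none => simp
    | some m =>
      cases hq : T.move (some m) b with
      | none => simp [run_cons, hq]
      | some q =>
        have := mem_of_move hq
        simp only [run_cons, hq, run_nil]
        simpa using Or.inr ⟨_, _, this⟩

namespace IsTableOf

variable {T : Table V B} {δ : X → B → X} {ρ : X → V} {F : Set (X × B)}

theorem move_eq (h : T.IsTableOf δ ρ F) (hρ : Function.Injective ρ) {x : X} {b : B}
    (hx : (x, b) ∈ F) : T.move (some (ρ x)) b = some (ρ (δ x b)) := by
  cases hm : T.move (some (ρ x)) b with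
  | none =>
    exact absurd hm (findKey_ne_none ((h _ _ _).2 ⟨x, hx, rfl, rfl⟩))
  | some q =>
    obtain ⟨y, -, h1, rfl⟩ := (h _ _ _).1 (mem_of_move hm)
    rw [hρ h1]

/-- A run whose transitions all lie in `F` does not get stuck. -/
theorem run_eq (h : T.IsTableOf δ ρ F) (hρ : Function.Injective ρ) :
    ∀ {w : List B} {x : X}, (∀ u b v, w = u ++ b :: v → (u.foldl δ x, b) ∈ F) →
      T.run (some (ρ x)) w = some (ρ (w.foldl δ x))
  | [], _, _ => rfl
  | b :: w, x, hw => by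
      rw [run_cons, h.move_eq hρ (x := x) (hw [] b w rfl)]
      exact run_eq h hρ fun u b' v e => hw (b :: u) b' v (by rw [e, List.cons_append])

/-- A run can get stuck outside `F`, but it never ends at a wrong state. -/
theorem eq_of_run_eq_some (h : T.IsTableOf δ ρ F) (hρ : Function.Injective ρ) {w : List B} {x : X}
    {q : V} (hw : T.run (some (ρ x)) w = some q) : q = ρ (w.foldl δ x) := by
  refine run_invariant (I := fun p x => p = ρ x) (fun p b q x hm hp => ?_) hw rfl
  obtain ⟨y, -, h1, rfl⟩ := (h _ _ _).1 hm
  rw [hρ (h1.symm.trans hp)]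

end IsTableOf

section Primrec

variable {α : Type*} [Primcodable α] [Primcodable V] [Primcodable B]

attribute [local fun_prop] Primrec
attribute [local fun_prop] Primrec.id Primrec.const Primrec.comp Primrec.pair Primrec.fst Primrec.snd

theorem primrec_move {T : α → Table V B} {o : α → Option V} {b : α → B} (hT : Primrec T)
    (ho : Primrec o) (hb : Primrec b) : Primrec fun a => (T a).move (o a) (b a) := by
  refine Primrec.option_bind ho (g := fun a p =>
    findKey (T a) (p, b a)) ?_
  exact Primrec.listLookup.comp (g := fun x : α × V => (x.2, b x.1)) (h := fun x : α × V => T x.1)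
    (by fun_prop) (by fun_prop)

theorem primrec_run {T : α → Table V B} {o : α → Option V} {w : α → List B} (hT : Primrec T)
    (ho : Primrec o) (hw : Primrec w) : Primrec fun a => (T a).run (o a) (w a) :=
  Primrec.list_foldl (h := fun a x => (T a).move x.1 x.2) hw ho
    (primrec_move (hT.comp Primrec.fst) (by fun_prop) (by fun_prop))

end Primrec

end Run

end Table

/-! ### Values of words and distances to a subgroup -/

section WordValues

variable {A G : Type*} [Group G] {μ : FreeGroup A →* G}

@[simp] theorem wordVal_nil : wordVal μ [] = 1 := map_one μ

@[simp] theorem wordVal_append (u v : Word A) :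
    wordVal μ (u ++ v) = wordVal μ u * wordVal μ v := by
  rw [wordVal, ← FreeGroup.mul_mk, map_mul]; rfl

theorem wordVal_cons (x : Letter A) (w : Word A) :
    wordVal μ (x :: w) = wordVal μ [x] * wordVal μ w := wordVal_append [x] w

@[simp] theorem wordVal_invRev (w : Word A) :
    wordVal μ (FreeGroup.invRev w) = (wordVal μ w)⁻¹ := by
  rw [wordVal, ← FreeGroup.inv_mk, map_inv]; rfl

theorem wordVal_singleton_true (a : A) : wordVal μ [(a, true)] = μ (FreeGroup.of a) := rfl

theorem wordVal_singleton_false (a : A) : wordVal μ [(a, false)] = (μ (FreeGroup.of a))⁻¹ :=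
  wordVal_invRev [(a, true)]

theorem foldl_mul_wordVal (g : G) (w : Word A) :
    w.foldl (fun g x => g * wordVal μ [x]) g = g * wordVal μ w := by
  induction w generalizing g with
  | nil => simp
  | cons x w ih => rw [List.foldl_cons, ih, wordVal_cons x w, mul_assoc]

theorem exists_wordVal_eq (hμ : Function.Surjective μ) (g : G) : ∃ w, wordVal μ w = g := by
  obtain ⟨x, rfl⟩ := hμ g
  obtain ⟨w, rfl⟩ := Quot.exists_rep x
  exact ⟨w, rfl⟩

/-- `g` lies at distance at most `m` from `H` in the Cayley graph: `g = h y` for some `h ∈ H` and a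
word `y` of length at most `m`. -/
def IsNear (μ : FreeGroup A →* G) (H : Subgroup G) (m : ℕ) (g : G) : Prop :=
  ∃ y : Word A, y.length ≤ m ∧ g * (wordVal μ y)⁻¹ ∈ H

theorem IsNear.mul {H : Subgroup G} {m n : ℕ} {g : G} (h : IsNear μ H m g) {y : Word A}
    (hy : y.length ≤ n) : IsNear μ H (m + n) (g * wordVal μ y) := by
  obtain ⟨z, hz, hg⟩ := h
  exact ⟨z ++ y, by simp; omega, by simpa [mul_assoc] using hg⟩

theorem exists_wordDist_le_iff (hμ : Function.Surjective μ) {H : Subgroup G} {m : ℕ} {g : G} :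
    (∃ s ∈ (H : Set G), wordDist μ s g ≤ m) ↔ IsNear μ H m g := by
  constructor
  · rintro ⟨s, hs, h⟩
    obtain ⟨w, hw⟩ := exists_wordVal_eq hμ (s⁻¹ * g)
    obtain ⟨y, hy, hyg⟩ := Nat.sInf_mem
      (s := {n | ∃ w : Word A, w.length = n ∧ wordVal μ w = s⁻¹ * g}) ⟨_, w, rfl, hw⟩
    refine ⟨y, hy.trans_le h, ?_⟩
    rw [hyg]
    simpa using hs
  · rintro ⟨y, hy, h⟩
    refine ⟨_, h, (Nat.sInf_le (m := y.length) ?_).trans hy⟩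
    exact ⟨y, rfl, by group⟩

theorem isQuasiConvexConst_iff (hμ : Function.Surjective μ) {L : Language (Letter A)}
    {H : Subgroup G} {k : ℕ} : IsQuasiConvexConst μ L (H : Set G) k ↔
      ∀ u v, u ++ v ∈ L → wordVal μ (u ++ v) ∈ H → IsNear μ H k (wordVal μ u) := by
  constructor
  · intro h u v hL hH
    exact (exists_wordDist_le_iff hμ).1 (h _ hL hH u ⟨v, rfl⟩)
  · rintro h _ hL hH u ⟨v, rfl⟩
    exact (exists_wordDist_le_iff hμ).2 (h u v hL hH)

/-- The elements of a finitely generated subgroup are the values of products of generators and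
their inverses. -/
theorem mem_subgroupOf_iff {hs : List (Word A)} {g : G} : g ∈ subgroupOf μ hs ↔
    ∃ z : List (Word A), (∀ y ∈ z, y ∈ hs ∨ FreeGroup.invRev y ∈ hs) ∧ wordVal μ z.flatten = g := by
  constructor
  · intro hg
    induction hg using Subgroup.closure_induction_right with
    | one => exact ⟨[], by simp⟩
    | mul_right x hx y hy ih =>
      obtain ⟨z, hz, rfl⟩ := ih
      obtain ⟨h, hh, rfl⟩ := hy
      refine ⟨z ++ [h], fun y hy => ?_, by simp⟩
      rcases List.mem_append.1 hy with hy | hy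
      · exact hz y hy
      · rw [List.mem_singleton.1 hy]
        exact .inl hh
    | mul_inv_cancel x hx y hy ih =>
      obtain ⟨z, hz, rfl⟩ := ih
      obtain ⟨h, hh, rfl⟩ := hy
      refine ⟨z ++ [FreeGroup.invRev h], fun y hy => ?_, by simp⟩
      rcases List.mem_append.1 hy with hy | hy
      · exact hz y hy
      · rw [List.mem_singleton.1 hy, FreeGroup.invRev_invRev]
        exact .inr hh
  · rintro ⟨z, hz, rfl⟩
    induction z with
    | nil => simp
    | cons y z ih =>
      rw [List.flatten_cons, wordVal_append]
      refine mul_mem ?_ (ih fun y hy => hz y (List.mem_cons_of_mem _ hy))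
      rcases hz y List.mem_cons_self with h | h
      · exact Subgroup.subset_closure ⟨y, h, rfl⟩
      · rw [← inv_mem_iff, ← wordVal_invRev]
        exact Subgroup.subset_closure ⟨_, h, rfl⟩

end WordValues

/-! ### Padded pairs of words -/

section Padding

variable {B : Type*}

theorem padPair_eq_append (t : ℕ) (u v : List B) :
    padPair u v = padPair (u.take t) (v.take t) ++ padPair (u.drop t) (v.drop t) := by
  induction t generalizing u v with
  | zero => simp [padPair]
  | succ t ih =>
    cases u with
    | nil => simp [padPair]
    | cons x u =>
      cases v with
      | nil => simp [padPair]
      | cons y v =>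
        exact congrArg (List.cons (some x, some y)) (ih u v)

theorem filterMap_fst_padPair : ∀ u v : List B, (padPair u v).filterMap Prod.fst = u
  | [], v => by simp [padPair, List.filterMap_map]
  | x :: u, [] => by simp [padPair, List.filterMap_map]
  | x :: u, y :: v => by
      have := filterMap_fst_padPair u v
      simp_all [padPair]

theorem filterMap_snd_padPair : ∀ u v : List B, (padPair u v).filterMap Prod.snd = v
  | [], v => by simp [padPair, List.filterMap_map]
  | x :: u, [] => by simp [padPair, List.filterMap_map]
  | x :: u, y :: v => by
      have := filterMap_snd_padPair u v
      simp_all [padPair]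

theorem primrec_padPair [Primcodable B] :
    Primrec fun x : List B × List B => padPair x.1 x.2 := by
  have h : Primrec fun x : List B × List B =>
      (List.range (max x.1.length x.2.length)).map fun i => (x.1[i]?, x.2[i]?) := by
    refine Primrec.list_map (Primrec.list_range.comp (Primrec.nat_max.comp
      (Primrec.list_length.comp Primrec.fst) (Primrec.list_length.comp Primrec.snd))) ?_
    exact Primrec.pair
      (Primrec.list_getElem?.comp (Primrec.fst.comp Primrec.fst) Primrec.snd)
      (Primrec.list_getElem?.comp (Primrec.snd.comp Primrec.fst) Primrec.snd)
  refine h.of_eq fun ⟨u, v⟩ => ?_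
  induction u generalizing v with
  | nil =>
    refine List.ext_getElem (by simp [padPair]) fun i h1 h2 => ?_
    simp [padPair]
  | cons x u ih =>
    cases v with
    | nil =>
      refine List.ext_getElem (by simp [padPair]) fun i h1 h2 => ?_
      cases i <;> simp [padPair]
    | cons y v =>
      have := ih v
      simp only [padPair, List.zipWithAll_cons_cons] at this ⊢
      rw [← this]
      simp [Nat.succ_max_succ, List.range_succ_eq_map]

end Padding

/-! ### Multipliers -/

section Multipliers

variable {A G : Type*} [Group G] {μ : FreeGroup A →* G} {L : Language (Letter A)}

/-- The pairs accepted by the multiplier of `a`. -/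
def Mult (μ : FreeGroup A →* G) (L : Language (Letter A)) (a : Option (Letter A)) (u v : Word A) :
    Prop :=
  u ∈ L ∧ v ∈ L ∧ wordVal μ (u ++ a.toList) = wordVal μ v

/-- The multipliers, combined into a single deterministic automaton with one acceptance condition
for each generator. -/
theorem IsAutomaticStructure.exists_machine [Finite A] (hL : IsAutomaticStructure μ L) :
    ∃ (n : ℕ) (step : Fin n → Option (Letter A) × Option (Letter A) → Fin n) (start : Fin n)
      (acc : Option (Letter A) → Fin n → Prop), ∀ a z,
        acc a (z.foldl step start) ↔ ∃ u v, Mult μ L a u v ∧ z = padPair u v := by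
  choose σ hσ M hM using hL.multiplier
  have : Finite (∀ a, σ a) := Pi.finite
  obtain ⟨n, ⟨e⟩⟩ := Finite.exists_equiv_fin (∀ a, σ a)
  refine ⟨n, fun s b => e fun a => (M a).step (e.symm s a) b, e fun a => (M a).start,
    fun a s => e.symm s a ∈ (M a).accept, fun a z => ?_⟩
  have key : ∀ (z : List _) (s : ∀ a, σ a), e.symm (z.foldl
      (fun s b => e fun a => (M a).step (e.symm s a) b) (e s)) a = (M a).evalFrom (s a) z := by
    intro z
    induction z with
    | nil => simp
    | cons b z ih => intro s; simp [ih]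
  beta_reduce
  rw [key]
  exact Set.ext_iff.1 (hM a) z

/-- Fellow travelling: since every state of a multiplier from which acceptance is possible admits
acceptance after boundedly many letters, multiplier pairs stay at bounded distance. -/
theorem IsAutomaticStructure.exists_fellow_travel [Finite A] (hL : IsAutomaticStructure μ L) :
    ∃ C : ℕ, ∀ a u v, Mult μ L a u v → ∀ t, ∃ y : Word A, y.length ≤ C ∧
      wordVal μ (v.take t) = wordVal μ (u.take t) * wordVal μ y := by
  classical
  obtain ⟨n, step, start, acc, hacc⟩ := hL.exists_machine
  choose! ζ hζ using fun (s : Option (Letter A) × Fin n)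
    (h : ∃ z : List _, acc s.1 (z.foldl step s.2)) => h
  obtain ⟨C, hC⟩ := (Set.finite_range fun s => (ζ s).length).bddAbove
  refine ⟨2 * C + 1, fun a u v h t => ?_⟩
  have h1 := (hacc a (padPair u v)).2 ⟨u, v, h, rfl⟩
  rw [padPair_eq_append t, List.foldl_append] at h1
  have h2 := hζ (a, _) ⟨_, h1⟩
  have h3 : (ζ (a, _)).length ≤ C :=
    hC ⟨(a, (padPair (u.take t) (v.take t)).foldl step start), rfl⟩
  revert h2 h3
  generalize ζ (a, (padPair (u.take t) (v.take t)).foldl step start) = z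
  intro h2 h3
  rw [← List.foldl_append] at h2
  obtain ⟨u', v', ⟨-, -, he⟩, h4⟩ := (hacc _ _).1 h2
  have hu := congrArg (List.filterMap Prod.fst) h4
  have hv := congrArg (List.filterMap Prod.snd) h4
  simp only [List.filterMap_append, filterMap_fst_padPair, filterMap_snd_padPair] at hu hv
  refine ⟨z.filterMap Prod.fst ++ a.toList ++ FreeGroup.invRev (z.filterMap Prod.snd), ?_, ?_⟩
  · have := List.length_filterMap_le Prod.fst z
    have := List.length_filterMap_le Prod.snd z
    have : a.toList.length ≤ 1 := by cases a <;> simp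
    simp only [List.length_append, FreeGroup.invRev_length]
    omega
  · rw [← hu, ← hv] at he
    simp only [wordVal_append] at he
    simp only [wordVal_append, wordVal_invRev, ← mul_assoc]
    rw [he]
    simp

/-- The words of `L` that represent elements near `H` stay near `H`. -/
theorem IsAutomaticStructure.exists_isNear_take [Finite A] (hμ : Function.Surjective μ)
    (hL : IsAutomaticStructure μ L) {H : Subgroup G} (hH : IsQuasiConvex μ L (H : Set G)) (m : ℕ) :
    ∃ K, ∀ v ∈ L, IsNear μ H m (wordVal μ v) → ∀ t, IsNear μ H K (wordVal μ (v.take t)) := by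
  obtain ⟨k, hk⟩ := hH
  rw [isQuasiConvexConst_iff hμ] at hk
  obtain ⟨C, hC⟩ := hL.exists_fellow_travel
  suffices key : ∀ (y v : Word A), v ∈ L → wordVal μ v * (wordVal μ y)⁻¹ ∈ H →
      ∀ t, IsNear μ H (k + C * y.length) (wordVal μ (v.take t)) by
    refine ⟨k + C * m, fun v hv ⟨y, hy, h⟩ t => ?_⟩
    obtain ⟨z, hz, h'⟩ := key y v hv h t
    exact ⟨z, hz.trans (by gcongr), h'⟩
  intro y
  induction y using List.reverseRecOn with
  | nil =>
    intro v hv h t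
    exact hk (v.take t) (v.drop t) (by simpa using hv) (by simpa using h)
  | append_singleton y x ih =>
    intro v hv h t
    obtain ⟨u, hu, hux⟩ := hL.rational.surj (wordVal μ v * (wordVal μ [x])⁻¹)
    obtain ⟨z, hz, h'⟩ := hC (some x) u v ⟨hu, hv, by simp [hux]⟩ t
    rw [h']
    have := (ih u hu (by simpa [hux, mul_assoc] using h) t).mul hz
    simpa [mul_add, add_assoc] using this

end Multipliers

/-! ### Semidecidable properties of an automatic structure -/

section Automatic

variable {A G : Type*} [Group G] {μ : FreeGroup A →* G} {L : Language (Letter A)}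

variable [Primcodable A] {α : Type*} [Primcodable α]

attribute [local fun_prop] Primrec
attribute [local fun_prop] Primrec.id Primrec.const Primrec.comp Primrec.pair Primrec.fst Primrec.snd

theorem primrec_invRev {w : α → Word A} (hw : Primrec w) :
    Primrec fun y => FreeGroup.invRev (w y) := by
  refine Primrec.list_reverse.comp (Primrec.list_map hw (g := fun _ x => (x.1, !x.2)) ?_)
  exact Primrec.pair (by fun_prop) (Primrec.not.comp (by fun_prop))

variable [Finite A]

theorem IsAutomaticStructure.sigmaOne_mult (hL : IsAutomaticStructure μ L)
    {a : α → Option (Letter A)} {u v : α → Word A} (ha : Primrec a) (hu : Primrec u)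
    (hv : Primrec v) : SigmaOne fun x => Mult μ L (a x) (u x) (v x) := by
  classical
  obtain ⟨n, step, start, acc, hacc⟩ := hL.exists_machine
  have hs : Primrec fun x => (padPair (u x) (v x)).foldl step start :=
    Primrec.list_foldl (h := fun _ y => step y.1 y.2) (primrec_padPair.comp (hu.pair hv))
      (Primrec.const start) ((Primrec.dom_finite fun y : Fin n × _ => step y.1 y.2).comp (by fun_prop))
  have hp : SigmaOne fun y : Option (Letter A) × Fin n => acc y.1 y.2 :=
    PrimrecPred.sigmaOne ⟨Classical.decPred _, Primrec.dom_finite _⟩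
  refine (hp.comp (ha.pair hs)).of_iff fun x => ?_
  rw [hacc]
  constructor
  · exact fun h => ⟨_, _, h, rfl⟩
  · rintro ⟨u', v', h, e⟩
    have h1 := congrArg (List.filterMap Prod.fst) e
    have h2 := congrArg (List.filterMap Prod.snd) e
    simp only [filterMap_fst_padPair, filterMap_snd_padPair] at h1 h2
    rwa [h1, h2]

variable [DecidableEq A]

/-- Multiplication by `a` takes the words of `L` that `T₁` reads from `1` to `p` to words that `T₂`
reads from `1` to `q`. The vertices of the tables are words, and the empty word stands for `1`. -/
def Closed (μ : FreeGroup A →* G) (L : Language (Letter A)) (T₁ T₂ : Table (Word A) (Letter A))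
    (a : Option (Letter A)) (p q : Word A) : Prop :=
  ∀ u v, Mult μ L a u v → T₁.run (some []) u = some p → T₂.run (some []) v = some q

/-- Whether multiplication by a generator is compatible with two finite tables is witnessed by an
invariant of the product of the multiplier with the tables. -/
theorem IsAutomaticStructure.sigmaOne_closed (hL : IsAutomaticStructure μ L)
    {T₁ T₂ : α → Table (Word A) (Letter A)} {a : α → Option (Letter A)} {p q : α → Word A}
    (hT₁ : Primrec T₁) (hT₂ : Primrec T₂) (ha : Primrec a) (hp : Primrec p) (hq : Primrec q) :
    SigmaOne fun x => Closed μ L (T₁ x) (T₂ x) (a x) (p x) (q x) := by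
  classical
  obtain ⟨n, step, start, acc, hacc⟩ := hL.exists_machine
  -- the product of the multipliers with the two tables, each reading one component of the pairs
  let stp : α → Fin n × Option (Word A) × Option (Word A) → Option (Letter A) × Option (Letter A) →
      Fin n × Option (Word A) × Option (Word A) := fun x s b =>
    (step s.1 b, b.1.elim s.2.1 ((T₁ x).move s.2.1), b.2.elim s.2.2 ((T₂ x).move s.2.2))
  have hfold : ∀ x z s, List.foldl (stp x) s z = (z.foldl step s.1,
      (T₁ x).run s.2.1 (z.filterMap Prod.fst), (T₂ x).run s.2.2 (z.filterMap Prod.snd)) := by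
    intro x z
    induction z with
    | nil => intro s; rfl
    | cons b z ih =>
      intro s
      rw [List.foldl_cons, ih]
      obtain ⟨_ | _, _ | _⟩ := b <;> rfl
  have hstep : Primrec fun y : Fin n × Option (Letter A) × Option (Letter A) => step y.1 y.2 :=
    Primrec.dom_finite _
  have helim : ∀ {T : α → Table (Word A) (Letter A)}, Primrec T →
      Primrec fun y : α × Option (Word A) × Option (Letter A) =>
        y.2.2.elim y.2.1 ((T y.1).move y.2.1) := fun {T} hT => by
    refine (Primrec.option_casesOn (o := fun y : α × Option (Word A) × Option (Letter A) => y.2.2)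
      (f := fun y => y.2.1) (g := fun y b => (T y.1).move y.2.1 b) (by fun_prop) (by fun_prop)
      (Primrec₂.mk (Table.primrec_move
        (hT.comp (Primrec.fst.comp Primrec.fst))
        (o := fun y : (α × Option (Word A) × Option (Letter A)) × Letter A => y.1.2.1)
        (b := fun y => y.2)
        (by fun_prop) (by fun_prop)))).of_eq ?_
    rintro ⟨x, o, _ | b⟩ <;> rfl
  have hstp : Primrec fun y : α × (Fin n × Option (Word A) × Option (Word A)) ×
      Option (Letter A) × Option (Letter A) => stp y.1 y.2.1 y.2.2 := by
    refine .pair (hstep.comp (g := fun y : α × (Fin n × Option (Word A) × Option (Word A)) ×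
      Option (Letter A) × Option (Letter A) => (y.2.1.1, y.2.2)) (by fun_prop)) (.pair ?_ ?_)
    · exact (helim hT₁).comp (g := fun y : α × (Fin n × Option (Word A) × Option (Word A)) ×
        Option (Letter A) × Option (Letter A) => (y.1, y.2.1.2.1, y.2.2.1)) (by fun_prop)
    · exact (helim hT₂).comp (g := fun y : α × (Fin n × Option (Word A) × Option (Word A)) ×
        Option (Letter A) × Option (Letter A) => (y.1, y.2.1.2.2, y.2.2.2)) (by fun_prop)
  have hacc' : SigmaOne fun y : Option (Letter A) × Fin n => ¬ acc y.1 y.2 :=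
    PrimrecPred.sigmaOne ⟨Classical.decPred _, Primrec.dom_finite _⟩
  refine (SigmaOne.forall_foldl (init := fun _ => (start, some [], some [])) (step := stp)
    (P := fun x s => ¬ acc (a x) s.1 ∨ s.2.1 ≠ some (p x) ∨ s.2.2 = some (q x))
    (Primrec.const _) hstp ?_ ?_).of_iff fun x => ?_
  · refine .or (hacc'.comp (f := fun y : α × Fin n × Option (Word A) × Option (Word A) =>
      (a y.1, y.2.1)) (by fun_prop)) (.or (.ne (by fun_prop) ?_) (.eq (by fun_prop) ?_))
    · exact Primrec.option_some.comp (by fun_prop)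
    · exact Primrec.option_some.comp (by fun_prop)
  · intro x
    refine (Set.finite_univ.prod (((T₁ x).finite_range_run []).prod
      ((T₂ x).finite_range_run []))).subset ?_
    rintro _ ⟨z, rfl⟩
    beta_reduce
    rw [hfold]
    exact ⟨trivial, ⟨_, rfl⟩, _, rfl⟩
  · simp only [hfold, hacc]
    constructor
    · intro h z
      by_contra! hz
      obtain ⟨⟨u, v, huv, rfl⟩, h1, h2⟩ := hz
      rw [filterMap_fst_padPair] at h1
      rw [filterMap_snd_padPair] at h2
      exact h2 (h u v huv h1)
    · intro h u v huv h1
      have := h (padPair u v)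
      rw [filterMap_fst_padPair, filterMap_snd_padPair] at this
      exact (this.resolve_left fun h => h ⟨u, v, huv, rfl⟩).resolve_left fun h => h h1

/-- Representatives in `L` are found letter by letter, with the multipliers. -/
theorem IsAutomaticStructure.sigmaOne_rep (hL : IsAutomaticStructure μ L) {w x : α → Word A}
    (hw : Primrec w) (hx : Primrec x) :
    SigmaOne fun y => x y ∈ L ∧ wordVal μ (x y) = wordVal μ (w y) := by
  choose ρ hρL hρ using hL.rational.surj
  have hinj : Function.Injective ρ := fun g h e => by rw [← hρ g, ← hρ h, e]
  have key : SigmaOne fun y => ∃ (T : Table (Word A) (Letter A)) (x' : Word A),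
      (∀ e ∈ T, Mult μ L (some e.1.2) e.1.1 e.2) ∧ T.run (some (ρ 1)) (w y) = some x' ∧
        Mult μ L none x' (x y) := by
    refine .ex (.ex (.and (.forall_mem (hL.sigmaOne_mult ?_ ?_ ?_) ?_) (.and (.eq
      (Table.primrec_run ?_ ?_ ?_) ?_) (hL.sigmaOne_mult ?_ ?_ ?_))))
    · exact Primrec.option_some.comp (by fun_prop)
    · fun_prop
    · fun_prop
    · fun_prop
    · fun_prop
    · fun_prop
    · fun_prop
    · exact Primrec.option_some.comp (by fun_prop)
    · fun_prop
    · fun_prop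
    · fun_prop
  refine key.of_iff fun y => ⟨?_, ?_⟩
  · rintro ⟨hxL, hxw⟩
    -- the table of the chosen representatives of the prefixes of the word
    obtain ⟨T, hT⟩ := Table.exists_isTableOf (fun g (b : Letter A) => g * wordVal μ [b]) ρ
      ((((w y).inits.map (wordVal μ)).finite_toSet).prod (Set.finite_univ (α := Letter A)))
    refine ⟨T, ρ (wordVal μ (w y)), ?_, ?_, hρL _, hxL, by simp [hρ, hxw]⟩
    · rintro ⟨⟨p, b⟩, q⟩ he
      obtain ⟨g, -, rfl, rfl⟩ := (hT _ _ _).1 he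
      exact ⟨hρL _, hρL _, by simp [hρ]⟩
    · rw [hT.run_eq hinj, foldl_mul_wordVal, one_mul]
      intro u b v e
      refine ⟨?_, trivial⟩
      rw [foldl_mul_wordVal, one_mul]
      exact List.mem_map_of_mem (f := wordVal μ) ((List.mem_inits _ _).2 ⟨b :: v, e.symm⟩)
  · rintro ⟨T, x', hT, hrun, hx'L, hxL, hxx'⟩
    have h := Table.run_invariant (δ := fun g (b : Letter A) => g * wordVal μ [b])
      (I := fun p g => wordVal μ p = g) (fun p b q g he hp => ?_) hrun (hρ 1)
    · rw [foldl_mul_wordVal, one_mul] at h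
      exact ⟨hxL, by simpa [h] using hxx'.symm⟩
    · have := (hT _ he).2.2
      rw [← hp, ← this]
      simp

theorem IsAutomaticStructure.sigmaOne_wordVal_eq_one (hL : IsAutomaticStructure μ L)
    {w : α → Word A} (hw : Primrec w) : SigmaOne fun y => wordVal μ (w y) = 1 := by
  obtain ⟨e, heL, he⟩ := hL.rational.surj 1
  refine (hL.sigmaOne_rep hw (Primrec.const e)).of_iff fun y => ?_
  rw [he, eq_comm]
  simp [heL]

theorem IsAutomaticStructure.sigmaOne_mem_subgroupOf (hL : IsAutomaticStructure μ L)
    {hs : α → List (Word A)} {w : α → Word A} (hhs : Primrec hs) (hw : Primrec w) :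
    SigmaOne fun y => wordVal μ (w y) ∈ subgroupOf μ (hs y) := by
  have key : SigmaOne fun y => ∃ z : List (Word A),
      (∀ h ∈ z, h ∈ hs y ∨ FreeGroup.invRev h ∈ hs y) ∧
        wordVal μ (z.flatten ++ FreeGroup.invRev (w y)) = 1 := by
    refine .ex (.and (.forall_mem (.or (.mem ?_ ?_) (.mem (primrec_invRev ?_) ?_)) ?_)
      (hL.sigmaOne_wordVal_eq_one (Primrec.list_append.comp (Primrec.list_flatten.comp ?_)
        (primrec_invRev ?_))))
    all_goals fun_prop
  refine key.of_iff fun y => ?_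
  simp only [mem_subgroupOf_iff, wordVal_append, wordVal_invRev, mul_inv_eq_one]

end Automatic

/-! ### Tables of cosets -/

section Cosets

variable {A G : Type*} [Group G] {μ : FreeGroup A →* G} {H : Subgroup G}

theorem rightCoset_eq_iff_mul_inv_mem {g g' : G} : rightCoset H g = rightCoset H g' ↔ g * g'⁻¹ ∈ H := by
  rw [eq_comm, rightCoset, rightCoset, Quotient.eq, QuotientGroup.rightRel_apply]

theorem rightCoset_eq_one_iff {g : G} : rightCoset H g = rightCoset H 1 ↔ g ∈ H := by
  simp [rightCoset_eq_iff_mul_inv_mem]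

theorem rightCoset_mul_eq {g g' : G} (h : rightCoset H g = rightCoset H g') (x : G) :
    rightCoset H (g * x) = rightCoset H (g' * x) := by
  rw [rightCoset_eq_iff_mul_inv_mem] at h ⊢
  simpa [mul_assoc] using h

theorem exists_rightCoset_eq (c : Quotient (QuotientGroup.rightRel H)) :
    ∃ g, rightCoset H g = c := Quotient.exists_rep c

/-- The action of the letters on the right cosets of `H`. -/
noncomputable def cosetMul (μ : FreeGroup A →* G) (H : Subgroup G)
    (c : Quotient (QuotientGroup.rightRel H)) (x : Letter A) :
    Quotient (QuotientGroup.rightRel H) :=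
  rightCoset H (c.out * wordVal μ [x])

theorem cosetMul_rightCoset (g : G) (x : Letter A) :
    cosetMul μ H (rightCoset H g) x = rightCoset H (g * wordVal μ [x]) :=
  rightCoset_mul_eq (Quotient.out_eq _) _

theorem foldl_cosetMul (g : G) (w : Word A) :
    w.foldl (cosetMul μ H) (rightCoset H g) = rightCoset H (g * wordVal μ w) := by
  induction w generalizing g with
  | nil => simp
  | cons x w ih => rw [List.foldl_cons, cosetMul_rightCoset, ih, wordVal_cons x w, mul_assoc]

/-- A choice of words representing the cosets, with the empty word for the coset `H`. -/
structure IsCosetRep (μ : FreeGroup A →* G) (H : Subgroup G)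
    (ρ : Quotient (QuotientGroup.rightRel H) → Word A) : Prop where
  rightCoset_wordVal : ∀ c, rightCoset H (wordVal μ (ρ c)) = c
  root : ρ (rightCoset H 1) = []

theorem exists_isCosetRep (hμ : Function.Surjective μ) (H : Subgroup G) :
    ∃ ρ, IsCosetRep μ H ρ := by
  classical
  choose w hw using fun c : Quotient (QuotientGroup.rightRel H) =>
    exists_wordVal_eq hμ (exists_rightCoset_eq c).choose
  refine ⟨fun c => if c = rightCoset H 1 then [] else w c, fun c => ?_, if_pos rfl⟩
  split_ifs with h
  · rw [wordVal_nil, h]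
  · rw [hw, (exists_rightCoset_eq c).choose_spec]

theorem IsCosetRep.injective {ρ : Quotient (QuotientGroup.rightRel H) → Word A}
    (hρ : IsCosetRep μ H ρ) : Function.Injective ρ := fun c d h => by
  rw [← hρ.1 c, ← hρ.1 d, h]

/-- The entries of the table describe edges of the Schreier graph, where a word used as a vertex
stands for its coset. -/
def IsValidTable (μ : FreeGroup A →* G) (H : Subgroup G) (T : Table (Word A) (Letter A)) : Prop :=
  ∀ e ∈ T, wordVal μ (e.1.1 ++ [e.1.2] ++ FreeGroup.invRev e.2) ∈ H

theorem isValidTable_iff {T : Table (Word A) (Letter A)} : IsValidTable μ H T ↔ ∀ e ∈ T,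
    rightCoset H (wordVal μ e.1.1 * wordVal μ [e.1.2]) = rightCoset H (wordVal μ e.2) := by
  simp only [IsValidTable, wordVal_append, wordVal_invRev, rightCoset_eq_iff_mul_inv_mem]

theorem Table.IsTableOf.isValidTable {T : Table (Word A) (Letter A)}
    {ρ : Quotient (QuotientGroup.rightRel H) → Word A}
    {F : Set (Quotient (QuotientGroup.rightRel H) × Letter A)}
    (hT : T.IsTableOf (cosetMul μ H) ρ F) (hρ : IsCosetRep μ H ρ) : IsValidTable μ H T := by
  rw [isValidTable_iff]
  rintro ⟨⟨p, b⟩, q⟩ he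
  obtain ⟨c, -, rfl, rfl⟩ := (hT _ _ _).1 he
  rw [hρ.1, ← cosetMul_rightCoset, hρ.1]

theorem finite_near_cosets [Finite A] (m : ℕ) :
    {c | ∃ g, rightCoset H g = c ∧ IsNear μ H m g}.Finite := by
  refine ((List.finite_length_le (Letter A) m).image fun y => rightCoset H (wordVal μ y)).subset ?_
  rintro _ ⟨g, rfl, y, hy, h⟩
  exact ⟨y, hy, (rightCoset_eq_iff_mul_inv_mem.2 h).symm⟩

variable [DecidableEq A]

theorem IsValidTable.rightCoset_run {T : Table (Word A) (Letter A)} (hT : IsValidTable μ H T)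
    {p q w : Word A} (h : T.run (some p) w = some q) :
    rightCoset H (wordVal μ q) = rightCoset H (wordVal μ p * wordVal μ w) := by
  rw [isValidTable_iff] at hT
  have := Table.run_invariant (δ := cosetMul μ H)
    (I := fun p c => rightCoset H (wordVal μ p) = c) (fun p b q c he hp => ?_) h rfl
  · rwa [foldl_cosetMul] at this
  · rw [← hp, cosetMul_rightCoset]
    exact (hT _ he).symm

/-- The loops of the table at `1` labeled by words of `L` are the words of `L` with value in `H`. -/
def Recognizes (μ : FreeGroup A →* G) (L : Language (Letter A)) (H : Subgroup G)
    (T : Table (Word A) (Letter A)) : Prop :=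
  ∀ w ∈ L, wordVal μ w ∈ H ↔ T.run (some []) w = some []

/-- A finite witness of the fact that `E` recognizes `L ∩ H`, for `H` generated by `hs`. The
language of the loops of `E` at `1` labeled by words of `L` contains a representative of `1`, and
it is closed under multiplication by the generators of `H` and their inverses: these label loops of
a table `Q`, each of whose entries `((p, x), q)` says that multiplication by `x` takes the words of
`L` ending at the vertex `p` of `E` to those ending at `q`. -/
structure IsCertificate (μ : FreeGroup A →* G) (L : Language (Letter A)) (hs : List (Word A))
    (E Q : Table (Word A) (Letter A)) : Prop where
  valid : IsValidTable μ (subgroupOf μ hs) E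
  one : ∃ x, (x ∈ L ∧ wordVal μ x = wordVal μ []) ∧ E.run (some []) x = some []
  closed_none : Closed μ L E E none [] []
  closed : ∀ e ∈ Q, Closed μ L E E (some e.1.2) e.1.1 e.2
  loop : ∀ h ∈ hs, Q.run (some []) h = some [] ∧ Q.run (some []) (FreeGroup.invRev h) = some []

variable {L : Language (Letter A)}

/-- Right multiplication by the generators of `H` preserves the set of elements that have a
representative in `L` which is a loop of `E` at `1`; this set therefore contains `H`. -/
theorem IsCertificate.recognizes {hs : List (Word A)} {E Q : Table (Word A) (Letter A)}
    (hL : IsAutomaticStructure μ L) (hE : IsCertificate μ L hs E Q) :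
    Recognizes μ L (subgroupOf μ hs) E := by
  -- a vertex `p` of `E` is reached by a representative of `g` in `L`
  let I : Word A → G → Prop := fun p g => ∃ v ∈ L, wordVal μ v = g ∧ E.run (some []) v = some p
  have hI : ∀ p b q g, ((p, b), q) ∈ Q → I p g → I q (g * wordVal μ [b]) := by
    rintro p b q g he ⟨u, huL, rfl, hu⟩
    obtain ⟨v, hvL, hv⟩ := hL.rational.surj (wordVal μ u * wordVal μ [b])
    exact ⟨v, hvL, hv, hE.closed _ he u v ⟨huL, hvL, by simp [hv]⟩ hu⟩
  have hrun : ∀ w g, Q.run (some []) w = some [] → I [] g → I [] (g * wordVal μ w) := by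
    intro w g hw hg
    have := Table.run_invariant hI hw hg
    rwa [foldl_mul_wordVal] at this
  intro w hwL
  constructor
  · intro hw
    suffices ∀ g ∈ subgroupOf μ hs, I [] g by
      obtain ⟨v, hvL, hv, h⟩ := this _ hw
      exact hE.closed_none v w ⟨hvL, hwL, by simpa using hv⟩ h
    intro g hg
    induction hg using Subgroup.closure_induction_right with
    | one =>
      obtain ⟨x, ⟨hxL, hx⟩, h⟩ := hE.one
      exact ⟨x, hxL, hx.trans wordVal_nil, h⟩
    | mul_right x hx y hy ih =>
      obtain ⟨h, hh, rfl⟩ := hy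
      exact hrun _ _ (hE.loop h hh).1 ih
    | mul_inv_cancel x hx y hy ih =>
      obtain ⟨h, hh, rfl⟩ := hy
      rw [← wordVal_invRev]
      exact hrun _ _ (hE.loop h hh).2 ih
  · intro h
    simpa [rightCoset_eq_one_iff, eq_comm] using hE.valid.rightCoset_run h

variable [Finite A]

/-- The part of the Schreier graph near `H` reads all words of `L` that end near `H`. -/
theorem IsQuasiConvex.exists_table (hμ : Function.Surjective μ) (hL : IsAutomaticStructure μ L)
    (hH : IsQuasiConvex μ L (H : Set G)) {ρ : Quotient (QuotientGroup.rightRel H) → Word A}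
    (hρ : IsCosetRep μ H ρ) (m : ℕ) :
    ∃ (E : Table (Word A) (Letter A)) (F : _), E.IsTableOf (cosetMul μ H) ρ F ∧
      ∀ w ∈ L, IsNear μ H m (wordVal μ w) →
        E.run (some []) w = some (ρ (rightCoset H (wordVal μ w))) := by
  obtain ⟨K, hK⟩ := hL.exists_isNear_take hμ hH m
  obtain ⟨E, hE⟩ := Table.exists_isTableOf (cosetMul μ H) ρ
    ((finite_near_cosets (μ := μ) (H := H) K).prod (Set.finite_univ (α := Letter A)))
  refine ⟨E, _, hE, fun w hwL hw => ?_⟩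
  rw [← hρ.root, hE.run_eq hρ.injective, foldl_cosetMul, one_mul]
  rintro u b v rfl
  rw [foldl_cosetMul, one_mul]
  exact ⟨⟨_, rfl, by simpa using hK _ hwL hw u.length⟩, trivial⟩

/-- The subgroup need not be finitely generated a priori, as the table is not computed here. -/
theorem IsQuasiConvex.exists_recognizes (hμ : Function.Surjective μ)
    (hL : IsAutomaticStructure μ L) (hH : IsQuasiConvex μ L (H : Set G)) :
    ∃ E, Recognizes μ L H E := by
  obtain ⟨ρ, hρ⟩ := exists_isCosetRep hμ H
  obtain ⟨E, F, hE, hrun⟩ := hH.exists_table hμ hL hρ 0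
  refine ⟨E, fun w hwL => ⟨fun hw => ?_, fun h => ?_⟩⟩
  · rw [hrun w hwL ⟨[], le_rfl, by simpa using hw⟩, rightCoset_eq_one_iff.2 hw, hρ.root]
  · simpa [rightCoset_eq_one_iff, eq_comm] using (hE.isValidTable hρ).rightCoset_run h

/-- A ball of the Schreier graph is a certificate if it reads all words of `L` that end within
distance `R + 1` of `H`, where the generators have length at most `R`; the ball of radius `R` serves
as the table of closed entries. -/
theorem IsQuasiConvex.exists_isCertificate (hμ : Function.Surjective μ)
    (hL : IsAutomaticStructure μ L) {hs : List (Word A)}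
    (hH : IsQuasiConvex μ L (subgroupOf μ hs : Set G)) : ∃ E Q, IsCertificate μ L hs E Q := by
  set H := subgroupOf μ hs with hHdef
  obtain ⟨ρ, hρ⟩ := exists_isCosetRep hμ H
  let R := (hs.map List.length).sum
  obtain ⟨E, F, hE, hrun⟩ := hH.exists_table hμ hL hρ (R + 1)
  obtain ⟨Q, hQ⟩ := Table.exists_isTableOf (cosetMul μ H) ρ
    ((finite_near_cosets (μ := μ) (H := H) R).prod (Set.finite_univ (α := Letter A)))
  have hend : ∀ u c, E.run (some []) u = some (ρ c) → c = rightCoset H (wordVal μ u) := by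
    intro u c h
    rw [← hρ.root] at h
    simpa [foldl_cosetMul] using hρ.injective (hE.eq_of_run_eq_some hρ.injective h)
  have hloop : ∀ w : Word A, w.length ≤ R → wordVal μ w ∈ H → Q.run (some []) w = some [] := by
    intro w hwR hw
    rw [← hρ.root, hQ.run_eq hρ.injective, foldl_cosetMul, one_mul, rightCoset_eq_one_iff.2 hw]
    rintro u b v rfl
    rw [foldl_cosetMul, one_mul]
    exact ⟨⟨_, rfl, u, by simp at hwR; omega, by simp⟩, trivial⟩
  have hlen : ∀ h ∈ hs, h.length ≤ R := fun h hh =>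
    List.single_le_sum (by simp) _ (List.mem_map_of_mem hh)
  have hmem : ∀ h ∈ hs, wordVal μ h ∈ H := fun h hh => Subgroup.subset_closure ⟨h, hh, rfl⟩
  refine ⟨E, Q, hE.isValidTable hρ, ?_, ?_, ?_, fun h hh => ⟨hloop h (hlen h hh) (hmem h hh),
    hloop _ (by simpa using hlen h hh) (by simpa using hmem h hh)⟩⟩
  · obtain ⟨x, hxL, hx⟩ := hL.rational.surj 1
    refine ⟨x, ⟨hxL, by simp [hx]⟩, ?_⟩
    rw [hrun x hxL ⟨[], by simp, by simp [hx]⟩, hx, hρ.root]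
  · rintro u v ⟨-, hv, huv⟩ hu
    have h1 : wordVal μ v ∈ H := by
      rw [← rightCoset_eq_one_iff, ← huv]
      simpa using (hend u (rightCoset H 1) (by rw [hu, hρ.root])).symm
    rw [hrun v hv ⟨[], by simp, by simpa using h1⟩, rightCoset_eq_one_iff.2 h1, hρ.root]
  · rintro ⟨⟨p, b⟩, q⟩ he u v ⟨-, hv, huv⟩ hu
    obtain ⟨c, ⟨⟨g, hgc, hg⟩, -⟩, rfl, rfl⟩ := (hQ _ _ _).1 he
    obtain ⟨y, hy, hgy⟩ := hg
    have hc := hend u c hu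
    have hvb : wordVal μ v = wordVal μ u * wordVal μ [b] := by simp [← huv]
    rw [hrun v hv, hvb, hc, cosetMul_rightCoset]
    have hnear : IsNear μ H R (wordVal μ u) := by
      refine ⟨y, hy, ?_⟩
      rw [← rightCoset_eq_iff_mul_inv_mem] at hgy ⊢
      exact hc.symm.trans (hgc.symm.trans hgy)
    rw [hvb]
    exact hnear.mul (by simp)

end Cosets

/-! ### Semidecidable facts about quasi-convex subgroups -/

section Witnesses

variable {A G : Type*} [Group G] {μ : FreeGroup A →* G} {L : Language (Letter A)} [DecidableEq A]

/-- Some certificate for the subgroup generated by `hs` rejects a representative of `w`. -/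
def HasNotMemWitness (μ : FreeGroup A →* G) (L : Language (Letter A)) (hs : List (Word A))
    (w : Word A) : Prop :=
  ∃ E Q, IsCertificate μ L hs E Q ∧
    ∃ x, (x ∈ L ∧ wordVal μ x = wordVal μ w) ∧ E.run (some []) x ≠ some []

/-- According to some certificate for the subgroup `H` generated by `hs`, all words of `L` with
value in `H` label loops of `T` at `1`. -/
def HasLoopsWitness (μ : FreeGroup A →* G) (L : Language (Letter A)) (hs : List (Word A))
    (T : Table (Word A) (Letter A)) : Prop :=
  ∃ E Q, IsCertificate μ L hs E Q ∧ Closed μ L E T none [] []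

section Correct

variable {hs : List (Word A)}

theorem HasNotMemWitness.notMem (hL : IsAutomaticStructure μ L) {w : Word A}
    (h : HasNotMemWitness μ L hs w) : wordVal μ w ∉ subgroupOf μ hs := by
  obtain ⟨E, Q, hE, x, ⟨hxL, hxw⟩, hx⟩ := h
  rw [← hxw, hE.recognizes hL x hxL]
  exact hx

theorem HasLoopsWitness.run_eq (hL : IsAutomaticStructure μ L) {T : Table (Word A) (Letter A)}
    (h : HasLoopsWitness μ L hs T) {w : Word A} (hw : w ∈ L) (hwH : wordVal μ w ∈ subgroupOf μ hs) :
    T.run (some []) w = some [] := by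
  obtain ⟨E, Q, hE, hT⟩ := h
  exact hT w w ⟨hw, hw, by simp⟩ ((hE.recognizes hL w hw).1 hwH)

variable [Finite A]

theorem hasNotMemWitness_iff (hμ : Function.Surjective μ) (hL : IsAutomaticStructure μ L)
    (hH : IsQuasiConvex μ L (subgroupOf μ hs : Set G)) {w : Word A} :
    HasNotMemWitness μ L hs w ↔ wordVal μ w ∉ subgroupOf μ hs := by
  refine ⟨fun h => h.notMem hL, fun h => ?_⟩
  obtain ⟨E, Q, hE⟩ := hH.exists_isCertificate hμ hL
  obtain ⟨x, hxL, hx⟩ := hL.rational.surj (wordVal μ w)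
  refine ⟨E, Q, hE, x, ⟨hxL, hx⟩, ?_⟩
  rwa [Ne, ← hE.recognizes hL x hxL, hx]

theorem hasLoopsWitness_of_forall (hμ : Function.Surjective μ) (hL : IsAutomaticStructure μ L)
    (hH : IsQuasiConvex μ L (subgroupOf μ hs : Set G)) {T : Table (Word A) (Letter A)}
    (hT : ∀ w ∈ L, wordVal μ w ∈ subgroupOf μ hs → T.run (some []) w = some []) :
    HasLoopsWitness μ L hs T := by
  obtain ⟨E, Q, hE⟩ := hH.exists_isCertificate hμ hL
  refine ⟨E, Q, hE, fun u v ⟨hu, hv, huv⟩ h => hT v hv ?_⟩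
  rw [← huv]
  simpa using (hE.recognizes hL u hu).2 h

/-- Quasi-convexity with constant `k` is witnessed by a part of the Schreier graph that reads all
words of `L` with value in `H` and that lies within distance `k` of the root. -/
theorem isQuasiConvexConst_iff_exists_table (hμ : Function.Surjective μ)
    (hL : IsAutomaticStructure μ L) (hH : IsQuasiConvex μ L (subgroupOf μ hs : Set G)) {k : ℕ} :
    IsQuasiConvexConst μ L (subgroupOf μ hs : Set G) k ↔
      ∃ T : Table (Word A) (Letter A), IsValidTable μ (subgroupOf μ hs) T ∧
        HasLoopsWitness μ L hs T ∧ ∀ e ∈ T, ∃ y : Word A, y.length ≤ k ∧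
          wordVal μ (e.1.1 ++ FreeGroup.invRev y) ∈ subgroupOf μ hs := by
  rw [isQuasiConvexConst_iff hμ]
  constructor
  · intro hk
    obtain ⟨ρ, hρ⟩ := exists_isCosetRep hμ (subgroupOf μ hs)
    obtain ⟨T, hT⟩ := Table.exists_isTableOf (cosetMul μ (subgroupOf μ hs)) ρ
      ((finite_near_cosets (μ := μ) (H := subgroupOf μ hs) k).prod
        (Set.finite_univ (α := Letter A)))
    refine ⟨T, hT.isValidTable hρ, hasLoopsWitness_of_forall hμ hL hH fun w hwL hw => ?_, ?_⟩
    · rw [← hρ.root, hT.run_eq hρ.injective, foldl_cosetMul, one_mul, rightCoset_eq_one_iff.2 hw]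
      rintro u b v rfl
      rw [foldl_cosetMul, one_mul]
      exact ⟨⟨_, rfl, hk _ _ hwL hw⟩, trivial⟩
    · rintro ⟨⟨p, b⟩, q⟩ he
      obtain ⟨c, ⟨⟨g, rfl, y, hy, hg⟩, -⟩, rfl, rfl⟩ := (hT _ _ _).1 he
      refine ⟨y, hy, ?_⟩
      rw [wordVal_append, wordVal_invRev, ← rightCoset_eq_iff_mul_inv_mem]
      exact (hρ.1 _).trans (rightCoset_eq_iff_mul_inv_mem.2 hg)
  · rintro ⟨T, hT, hloops, hy⟩ u v hwL hw
    obtain ⟨m, hm, hv⟩ := Table.exists_run_of_run_append (hloops.run_eq hL hwL hw)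
    cases v with
    | nil => exact ⟨[], by simp, by simpa using hw⟩
    | cons x v =>
      obtain ⟨m', hm', -⟩ := Table.exists_move_of_run_cons hv
      obtain ⟨y, hyk, h⟩ := hy _ (Table.mem_of_move hm')
      refine ⟨y, hyk, ?_⟩
      rw [wordVal_append, wordVal_invRev, ← rightCoset_eq_iff_mul_inv_mem] at h
      rw [← rightCoset_eq_iff_mul_inv_mem, ← h]
      simpa using (hT.rightCoset_run hm).symm

/-- A failure of quasi-convexity with constant `k` is witnessed by a prefix of a word of `L` and a
finite list that contains all words of length at most `k`. -/
theorem not_isQuasiConvexConst_iff (hμ : Function.Surjective μ) (hL : IsAutomaticStructure μ L)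
    (hH : IsQuasiConvex μ L (subgroupOf μ hs : Set G)) {l : List (Letter A)} (hl : ∀ x, x ∈ l)
    {k : ℕ} : ¬ IsQuasiConvexConst μ L (subgroupOf μ hs : Set G) k ↔
      ∃ u v : Word A, ∃ W : List (Word A), Mult μ L none (u ++ v) (u ++ v) ∧
        wordVal μ (u ++ v) ∈ subgroupOf μ hs ∧ [] ∈ W ∧
        (∀ x ∈ W, k ≤ x.length ∨ ∀ a ∈ l, x ++ [a] ∈ W) ∧
        ∀ x ∈ W, HasNotMemWitness μ L hs (u ++ FreeGroup.invRev x) := by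
  rw [isQuasiConvexConst_iff hμ]
  constructor
  · intro h
    push Not at h
    obtain ⟨u, v, hL', hw, hu⟩ := h
    refine ⟨u, v, (List.finite_length_le (Letter A) k).toFinset.toList, ⟨hL', hL', by simp⟩, hw,
      by simp, fun x hx => ?_, fun x hx => ?_⟩
    · rcases le_or_gt k x.length with h | h
      · exact .inl h
      · exact .inr fun a _ => by simpa using h
    · rw [hasNotMemWitness_iff hμ hL hH, wordVal_append, wordVal_invRev]
      exact fun h => hu ⟨x, by simpa using hx, h⟩
  · rintro ⟨u, v, W, ⟨hL', -⟩, hw, h0, hW, h⟩ hk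
    have hall : ∀ x : Word A, x.length ≤ k → x ∈ W := by
      intro x
      induction x using List.reverseRecOn with
      | nil => exact fun _ => h0
      | append_singleton x a ih =>
        intro hx
        rw [List.length_append, List.length_singleton] at hx
        exact ((hW x (ih (by omega))).resolve_left (by omega)) a (hl a)
    obtain ⟨y, hy, hyu⟩ := hk u v hL' hw
    refine (h y (hall y hy)).notMem hL ?_
    simpa using hyu

end Correct

section Semidecidable

variable [Primcodable A] [Finite A] {α : Type*} [Primcodable α]

attribute [local fun_prop] Primrec
attribute [local fun_prop] Primrec.id Primrec.const Primrec.comp Primrec.pair Primrec.fst Primrec.snd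
attribute [local fun_prop] primrec_invRev

@[local fun_prop]
theorem primrec_append {β : Type*} [Primcodable β] {f g : α → List β} (hf : Primrec f)
    (hg : Primrec g) : Primrec fun x => f x ++ g x := Primrec.list_append.comp hf hg

@[local fun_prop]
theorem primrec_cons {β : Type*} [Primcodable β] {f : α → β} {g : α → List β} (hf : Primrec f)
    (hg : Primrec g) : Primrec fun x => f x :: g x := Primrec.list_cons.comp hf hg

@[local fun_prop]
theorem primrec_some {β : Type*} [Primcodable β] {f : α → β} (hf : Primrec f) :
    Primrec fun x => some (f x) := Primrec.option_some.comp hf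

@[local fun_prop]
theorem primrec_length {β : Type*} [Primcodable β] {f : α → List β} (hf : Primrec f) :
    Primrec fun x => (f x).length := Primrec.list_length.comp hf

theorem IsAutomaticStructure.sigmaOne_isValidTable (hL : IsAutomaticStructure μ L)
    {hs : α → List (Word A)} {T : α → Table (Word A) (Letter A)} (hhs : Primrec hs)
    (hT : Primrec T) : SigmaOne fun x => IsValidTable μ (subgroupOf μ (hs x)) (T x) :=
  .forall_mem (hL.sigmaOne_mem_subgroupOf (by fun_prop) (by fun_prop)) hT

theorem IsAutomaticStructure.sigmaOne_isCertificate (hL : IsAutomaticStructure μ L)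
    {hs : α → List (Word A)} {E Q : α → Table (Word A) (Letter A)} (hhs : Primrec hs)
    (hE : Primrec E) (hQ : Primrec Q) : SigmaOne fun x => IsCertificate μ L (hs x) (E x) (Q x) := by
  have key : SigmaOne fun x => IsValidTable μ (subgroupOf μ (hs x)) (E x) ∧
      (∃ y, (y ∈ L ∧ wordVal μ y = wordVal μ []) ∧ (E x).run (some []) y = some []) ∧
      Closed μ L (E x) (E x) none [] [] ∧
      (∀ e ∈ Q x, Closed μ L (E x) (E x) (some e.1.2) e.1.1 e.2) ∧
      ∀ h ∈ hs x, (Q x).run (some []) h = some [] ∧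
        (Q x).run (some []) (FreeGroup.invRev h) = some [] := by
    refine .and (hL.sigmaOne_isValidTable hhs hE) (.and (.ex (.and (hL.sigmaOne_rep ?_ ?_)
      (.eq (Table.primrec_run ?_ ?_ ?_) ?_))) (.and (hL.sigmaOne_closed ?_ ?_ ?_ ?_ ?_)
      (.and (.forall_mem (hL.sigmaOne_closed ?_ ?_ ?_ ?_ ?_) ?_)
        (.forall_mem (.and (.eq (Table.primrec_run ?_ ?_ ?_) ?_)
          (.eq (Table.primrec_run ?_ ?_ ?_) ?_)) ?_))))
    all_goals fun_prop
  exact key.of_iff fun x => ⟨fun h => ⟨h.1, h.2, h.3, h.4, h.5⟩, fun ⟨h1, h2, h3, h4, h5⟩ =>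
    ⟨h1, h2, h3, h4, h5⟩⟩

theorem IsAutomaticStructure.sigmaOne_hasNotMemWitness (hL : IsAutomaticStructure μ L)
    {hs : α → List (Word A)} {w : α → Word A} (hhs : Primrec hs) (hw : Primrec w) :
    SigmaOne fun x => HasNotMemWitness μ L (hs x) (w x) := by
  refine .ex (.ex (.and (hL.sigmaOne_isCertificate ?_ ?_ ?_) (.ex (.and (hL.sigmaOne_rep ?_ ?_)
    (.ne (Table.primrec_run ?_ ?_ ?_) ?_)))))
  all_goals fun_prop

theorem IsAutomaticStructure.sigmaOne_hasLoopsWitness (hL : IsAutomaticStructure μ L)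
    {hs : α → List (Word A)} {T : α → Table (Word A) (Letter A)} (hhs : Primrec hs)
    (hT : Primrec T) : SigmaOne fun x => HasLoopsWitness μ L (hs x) (T x) := by
  refine .ex (.ex (.and (hL.sigmaOne_isCertificate ?_ ?_ ?_)
    (hL.sigmaOne_closed ?_ ?_ ?_ ?_ ?_)))
  all_goals fun_prop

end Semidecidable

end Witnesses

/-! ### Membership and constants of quasi-convexity -/

section Algorithms

variable {A G : Type*} [Group G] {μ : FreeGroup A →* G} {L : Language (Letter A)}

theorem IsQuasiConvexConst.mono {S : Set G} {k m : ℕ} (hk : IsQuasiConvexConst μ L S k)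
    (h : k ≤ m) : IsQuasiConvexConst μ L S m := fun w hw hwS u hu =>
  let ⟨s, hs, hd⟩ := hk w hw hwS u hu
  ⟨s, hs, hd.trans h⟩

variable [DecidableEq A] [Primcodable A] [Finite A]

attribute [local fun_prop] Primrec
attribute [local fun_prop] Primrec.id Primrec.const Primrec.comp Primrec.pair Primrec.fst Primrec.snd
attribute [local fun_prop] primrec_invRev primrec_append primrec_cons primrec_some primrec_length

/-- Membership and non-membership are searched for in parallel. -/
theorem exists_partrec_mem (hμ : Function.Surjective μ) (hL : IsAutomaticStructure μ L) :
    ∃ member : List (Word A) × Word A →. Bool, Partrec member ∧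
      ∀ hs, IsQuasiConvex μ L (subgroupOf μ hs : Set G) →
        ∀ w, ∃ b ∈ member (hs, w), (b = true ↔ wordVal μ w ∈ subgroupOf μ hs) := by
  have hp : SigmaOne fun x : (List (Word A) × Word A) × Bool =>
      (x.2 = true ∧ wordVal μ x.1.2 ∈ subgroupOf μ x.1.1) ∨
        (x.2 = false ∧ HasNotMemWitness μ L x.1.1 x.1.2) := by
    refine .or (.and (.eq ?_ ?_) (hL.sigmaOne_mem_subgroupOf ?_ ?_))
      (.and (.eq ?_ ?_) (hL.sigmaOne_hasNotMemWitness ?_ ?_))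
    all_goals fun_prop
  obtain ⟨f, hf, h1, h2⟩ := SigmaOne.exists_partrec (p := fun (y : List (Word A) × Word A) b =>
    (b = true ∧ wordVal μ y.2 ∈ subgroupOf μ y.1) ∨ (b = false ∧ HasNotMemWitness μ L y.1 y.2)) hp
  refine ⟨f, hf, fun hs hH w => ?_⟩
  have hdom : (f (hs, w)).Dom := by
    refine h2 (hs, w) ?_
    by_cases hw : wordVal μ w ∈ subgroupOf μ hs
    · exact ⟨true, .inl ⟨rfl, hw⟩⟩
    · exact ⟨false, .inr ⟨rfl, (hasNotMemWitness_iff hμ hL hH).2 hw⟩⟩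
  refine ⟨_, Part.get_mem hdom, ?_⟩
  rcases h1 _ _ (Part.get_mem hdom) with ⟨h, hw⟩ | ⟨h, hw⟩
  · simp [h, hw]
  · simp [h, hw.notMem hL]

theorem computablePred_mem_of_isQuasiConvex (hμ : Function.Surjective μ)
    (hL : IsAutomaticStructure μ L) {H : Subgroup G} (hH : IsQuasiConvex μ L (H : Set G)) :
    ComputablePred fun w : Word A => wordVal μ w ∈ H := by
  obtain ⟨E, hE⟩ := hH.exists_recognizes hμ hL
  rw [ComputablePred.computable_iff_re_compl_re']
  have h1 : SigmaOne fun w : Word A => ∃ x, (x ∈ L ∧ wordVal μ x = wordVal μ w) ∧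
      E.run (some []) x = some [] := by
    refine .ex (.and (hL.sigmaOne_rep ?_ ?_) (.eq (Table.primrec_run ?_ ?_ ?_) ?_))
    all_goals fun_prop
  have h2 : SigmaOne fun w : Word A => ∃ x, (x ∈ L ∧ wordVal μ x = wordVal μ w) ∧
      E.run (some []) x ≠ some [] := by
    refine .ex (.and (hL.sigmaOne_rep ?_ ?_) (.ne (Table.primrec_run ?_ ?_ ?_) ?_))
    all_goals fun_prop
  refine ⟨(h1.of_iff fun w => ?_).rePred, (h2.of_iff fun w => ?_).rePred⟩
  · constructor
    · intro hw
      obtain ⟨x, hxL, hx⟩ := hL.rational.surj (wordVal μ w)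
      exact ⟨x, ⟨hxL, hx⟩, (hE x hxL).1 (hx ▸ hw)⟩
    · rintro ⟨x, ⟨hxL, hx⟩, h⟩
      exact hx ▸ (hE x hxL).2 h
  · constructor
    · intro hw
      obtain ⟨x, hxL, hx⟩ := hL.rational.surj (wordVal μ w)
      exact ⟨x, ⟨hxL, hx⟩, fun h => hw (hx ▸ (hE x hxL).2 h)⟩
    · rintro ⟨x, ⟨hxL, hx⟩, h⟩ hw
      exact h ((hE x hxL).1 (hx ▸ hw))

theorem exists_partrec_isLeast_const (hμ : Function.Surjective μ) (hL : IsAutomaticStructure μ L) :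
    ∃ const : List (Word A) →. ℕ, Partrec const ∧
      ∀ hs, IsQuasiConvex μ L (subgroupOf μ hs : Set G) →
        ∃ k ∈ const hs, IsLeast {k | IsQuasiConvexConst μ L (subgroupOf μ hs : Set G) k} k := by
  classical
  obtain ⟨l, hl⟩ : ∃ l : List (Letter A), ∀ x, x ∈ l := by
    have := Fintype.ofFinite (Letter A)
    exact ⟨Finset.univ.toList, by simp⟩
  -- `k` is a constant, and `k - 1` is not one unless `k = 0`
  let p : List (Word A) → ℕ → Prop := fun hs k =>
    (∃ T : Table (Word A) (Letter A), IsValidTable μ (subgroupOf μ hs) T ∧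
      HasLoopsWitness μ L hs T ∧ ∀ e ∈ T, ∃ y : Word A, y.length ≤ k ∧
        wordVal μ (e.1.1 ++ FreeGroup.invRev y) ∈ subgroupOf μ hs) ∧
    (k = 0 ∨ ∃ u v : Word A, ∃ W : List (Word A), Mult μ L none (u ++ v) (u ++ v) ∧
        wordVal μ (u ++ v) ∈ subgroupOf μ hs ∧ [] ∈ W ∧
        (∀ x ∈ W, k - 1 ≤ x.length ∨ ∀ a ∈ l, x ++ [a] ∈ W) ∧
        ∀ x ∈ W, HasNotMemWitness μ L hs (u ++ FreeGroup.invRev x))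
  have hpred : Primrec fun k : ℕ => k - 1 := Primrec.pred
  have hp : SigmaOne fun x : List (Word A) × ℕ => p x.1 x.2 := by
    refine .and (.ex (.and (hL.sigmaOne_isValidTable ?_ ?_) (.and (hL.sigmaOne_hasLoopsWitness ?_ ?_)
      (.forall_mem (.ex (.and (.le ?_ ?_) (hL.sigmaOne_mem_subgroupOf ?_ ?_))) ?_))))
      (.or (.eq ?_ ?_) (.ex (.ex (.ex (.and (hL.sigmaOne_mult ?_ ?_ ?_)
        (.and (hL.sigmaOne_mem_subgroupOf ?_ ?_) (.and (.mem ?_ ?_)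
        (.and (.forall_mem (.or (.le (hpred.comp ?_) ?_) (.forall_mem (.mem ?_ ?_) ?_)) ?_)
          (.forall_mem (hL.sigmaOne_hasNotMemWitness ?_ ?_) ?_)))))))))
    all_goals fun_prop
  have hiff : ∀ hs, IsQuasiConvex μ L (subgroupOf μ hs : Set G) → ∀ k, p hs k ↔
      IsQuasiConvexConst μ L (subgroupOf μ hs : Set G) k ∧
        (k = 0 ∨ ¬ IsQuasiConvexConst μ L (subgroupOf μ hs : Set G) (k - 1)) := fun hs hH k => by
    rw [isQuasiConvexConst_iff_exists_table hμ hL hH, not_isQuasiConvexConst_iff hμ hL hH hl]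
  obtain ⟨f, hf, h1, h2⟩ := SigmaOne.exists_partrec hp
  refine ⟨f, hf, fun hs hH => ?_⟩
  have hdom : (f hs).Dom := by
    refine h2 hs ⟨Nat.find hH, (hiff hs hH _).2 ⟨Nat.find_spec hH, ?_⟩⟩
    rcases Nat.eq_zero_or_pos (Nat.find hH) with h | h
    · exact .inl h
    · exact .inr (Nat.find_min hH (by omega))
  refine ⟨_, Part.get_mem hdom, ?_⟩
  obtain ⟨h3, h4⟩ := (hiff hs hH _).1 (h1 _ _ (Part.get_mem hdom))
  refine ⟨h3, fun j hj => ?_⟩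
  by_contra! hlt
  rcases h4 with h4 | h4
  · omega
  · exact h4 (IsQuasiConvexConst.mono hj (by omega))

end Algorithms

/-! ### Stallings graphs -/

/-- A map between vertices that is bijective and respects root and edges is an isomorphism. -/
theorem RootedGraph.iso_of_bijOn {A V V' : Type*} {Γ : RootedGraph A V} {Δ : RootedGraph A V'}
    (γ : V → V') (hγ : Set.BijOn γ Γ.verts Δ.verts) (hroot : γ Γ.root = Δ.root)
    (hedge : ∀ p ∈ Γ.verts, ∀ q ∈ Γ.verts, ∀ a, Γ.edge p a q ↔ Δ.edge (γ p) a (γ q)) : Γ.Iso Δ :=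
  ⟨hγ.equiv γ, Subtype.ext hroot, fun p q a => hedge p p.2 q q.2 a⟩

section Stallings

variable {A G : Type*} [Group G] {μ : FreeGroup A →* G} {L : Language (Letter A)} {H : Subgroup G}

theorem schreierGraph_step_iff {p q : Quotient (QuotientGroup.rightRel H)} {x : Letter A} :
    (schreierGraph μ H).Step p x q ↔ q = cosetMul μ H p x := by
  obtain ⟨g, rfl⟩ := exists_rightCoset_eq p
  obtain ⟨g', rfl⟩ := exists_rightCoset_eq q
  rw [cosetMul_rightCoset]
  obtain ⟨a, _ | _⟩ := x
  · simp only [RootedGraph.Step, schreierGraph, wordVal_singleton_false, Bool.false_eq_true,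
      false_and, true_and, false_or]
    constructor
    · rintro ⟨f, h1, h2⟩
      rw [h1, rightCoset_mul_eq h2]
      simp
    · intro h
      exact ⟨_, h, by simp⟩
  · simp only [RootedGraph.Step, schreierGraph, wordVal_singleton_true, Bool.true_eq_false,
      false_and, true_and, or_false]
    constructor
    · rintro ⟨f, h1, h2⟩
      rw [h2, rightCoset_mul_eq h1]
    · intro h
      exact ⟨_, rfl, h⟩

theorem schreierGraph_edge_iff {p q : Quotient (QuotientGroup.rightRel H)} {a : A} :
    (schreierGraph μ H).edge p a q ↔ q = cosetMul μ H p (a, true) := by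
  rw [← schreierGraph_step_iff]
  simp [RootedGraph.Step]

theorem cosetMul_true_false_iff {p q : Quotient (QuotientGroup.rightRel H)} {a : A} :
    p = cosetMul μ H q (a, false) ↔ q = cosetMul μ H p (a, true) := by
  rw [← schreierGraph_step_iff, ← schreierGraph_edge_iff]
  simp [RootedGraph.Step]

theorem schreierGraph_reads_iff {p q : Quotient (QuotientGroup.rightRel H)} {w : Word A} :
    (schreierGraph μ H).Reads p w q ↔ q = w.foldl (cosetMul μ H) p := by
  induction w generalizing p with
  | nil => exact eq_comm
  | cons x w ih => simp [RootedGraph.Reads, ih, schreierGraph_step_iff]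

/-- `w` is an `L`-representative of an element of `H`, and `p` is the coset of `u`. For a prefix `u`
of `w`, this says that the loop labeled by `w` visits `p` after reading `u`. -/
def IsVisited (μ : FreeGroup A →* G) (L : Language (Letter A)) (H : Subgroup G)
    (p : Quotient (QuotientGroup.rightRel H)) (u w : Word A) : Prop :=
  w ∈ L ∧ wordVal μ w ∈ H ∧ p = rightCoset H (wordVal μ u)

theorem stallingsGraph_edge_iff {p q : Quotient (QuotientGroup.rightRel H)} {a : A} :
    (stallingsGraph μ L H).edge p a q ↔ q = cosetMul μ H p (a, true) ∧ ∃ u v,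
      IsVisited μ L H p u (u ++ (a, true) :: v) ∨ IsVisited μ L H q u (u ++ (a, false) :: v) := by
  have hroot : (schreierGraph μ H).root = rightCoset H 1 := rfl
  simp only [stallingsGraph, RootedGraph.spannedByLoops, schreierGraph_edge_iff,
    schreierGraph_reads_iff, hroot, foldl_cosetMul, one_mul, Set.mem_ofPred_eq, IsVisited]
  refine and_congr_right fun hpq => exists_congr fun u => exists_congr fun v => or_congr ?_ ?_
  · constructor
    · exact fun h => ⟨h.1.1, h.1.2, h.2.1⟩
    · rintro ⟨h1, h2, rfl⟩
      refine ⟨⟨h1, h2⟩, rfl, ?_⟩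
      rw [hpq, ← List.foldl_cons, foldl_cosetMul, ← wordVal_append, rightCoset_eq_one_iff.2 h2]
  · constructor
    · exact fun h => ⟨h.1.1, h.1.2, h.2.1⟩
    · rintro ⟨h1, h2, rfl⟩
      refine ⟨⟨h1, h2⟩, rfl, ?_⟩
      rw [cosetMul_true_false_iff.2 hpq, ← List.foldl_cons, foldl_cosetMul, ← wordVal_append,
        rightCoset_eq_one_iff.2 h2]

/-- The vertices of the Stallings graph are the root and the ends of the edges. -/
theorem mem_stallingsGraph_verts_iff {p : Quotient (QuotientGroup.rightRel H)} :
    p ∈ (stallingsGraph μ L H).verts ↔ p = rightCoset H 1 ∨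
      ∃ a q, (stallingsGraph μ L H).edge p a q ∨ (stallingsGraph μ L H).edge q a p := by
  constructor
  · rintro (h | ⟨u, v, hw, h1, h2⟩)
    · exact .inl h
    · cases v with
      | nil => exact .inl h2
      | cons x v =>
        obtain ⟨q, hq, hv⟩ := h2
        obtain ⟨a, _ | _⟩ := x
        · obtain h | ⟨-, h⟩ := hq
          · simp at h
          · exact .inr ⟨a, q, .inr ⟨h, u, v, .inr ⟨hw, h1, hv⟩⟩⟩
        · obtain ⟨-, h⟩ | h := hq
          · exact .inr ⟨a, q, .inl ⟨h, u, v, .inl ⟨hw, h1, hv⟩⟩⟩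
          · simp at h
  · rintro (h | ⟨a, q, h | h⟩)
    · exact .inl h
    · exact (stallingsGraph μ L H).edge_src h
    · exact (stallingsGraph μ L H).edge_tgt h

/-- Reading the word `u ++ x :: v` of `L` with value in `H`, the letter `x` traverses an edge of the
Stallings graph. -/
theorem stallingsGraph_edge_of_mem {u v : Word A} {x : Letter A} (hL : u ++ x :: v ∈ L)
    (hH : wordVal μ (u ++ x :: v) ∈ H) :
    (stallingsGraph μ L H).Step (rightCoset H (wordVal μ u)) x
      (cosetMul μ H (rightCoset H (wordVal μ u)) x) := by
  obtain ⟨a, _ | _⟩ := x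
  · exact .inr ⟨rfl, stallingsGraph_edge_iff.2
      ⟨cosetMul_true_false_iff.1 rfl, u, v, .inr ⟨hL, hH, rfl⟩⟩⟩
  · exact .inl ⟨rfl, stallingsGraph_edge_iff.2 ⟨rfl, u, v, .inl ⟨hL, hH, rfl⟩⟩⟩

theorem IsQuasiConvex.finite_stallingsGraph_verts [Finite A] (hμ : Function.Surjective μ)
    (hH : IsQuasiConvex μ L (H : Set G)) : (stallingsGraph μ L H).verts.Finite := by
  obtain ⟨k, hk⟩ := hH
  rw [isQuasiConvexConst_iff hμ] at hk
  refine (finite_near_cosets (μ := μ) (H := H) k).subset fun p hp => ?_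
  rcases hp with rfl | ⟨u, v, ⟨hwL, hw⟩, h1, -⟩
  · exact ⟨1, rfl, [], by simp, by simp⟩
  · rw [schreierGraph_reads_iff] at h1
    refine ⟨wordVal μ u, ?_, hk u v hwL hw⟩
    rw [h1]
    exact ((foldl_cosetMul 1 u).trans (by rw [one_mul])).symm

end Stallings

/-! ### Computing Stallings graphs -/

section Compute

variable {r : ℕ} {G : Type*} [Group G] {μ : FreeGroup (Fin r) →* G} {L : Language (Letter (Fin r))}

theorem mult_none_self_iff {w : Word (Fin r)} : Mult μ L none w w ↔ w ∈ L := by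
  simp [Mult]

/-- The cosets of the words `p` and `q` are joined by an edge of the Stallings graph, for the
subgroup generated by `hs`. -/
def HasEdgeWitness (μ : FreeGroup (Fin r) →* G) (L : Language (Letter (Fin r)))
    (hs : List (Word (Fin r))) (p : Word (Fin r)) (a : Fin r) (q : Word (Fin r)) : Prop :=
  wordVal μ (p ++ [(a, true)] ++ FreeGroup.invRev q) ∈ subgroupOf μ hs ∧
    ∃ u v, (Mult μ L none (u ++ (a, true) :: v) (u ++ (a, true) :: v) ∧
        wordVal μ (u ++ (a, true) :: v) ∈ subgroupOf μ hs ∧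
        wordVal μ (p ++ FreeGroup.invRev u) ∈ subgroupOf μ hs) ∨
      (Mult μ L none (u ++ (a, false) :: v) (u ++ (a, false) :: v) ∧
        wordVal μ (u ++ (a, false) :: v) ∈ subgroupOf μ hs ∧
        wordVal μ (q ++ FreeGroup.invRev u) ∈ subgroupOf μ hs)

theorem hasEdgeWitness_iff {hs : List (Word (Fin r))} {p q : Word (Fin r)} {a : Fin r} :
    HasEdgeWitness μ L hs p a q ↔ (stallingsGraph μ L (subgroupOf μ hs)).edge
      (rightCoset _ (wordVal μ p)) a (rightCoset _ (wordVal μ q)) := by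
  rw [stallingsGraph_edge_iff]
  simp only [HasEdgeWitness, wordVal_append, wordVal_invRev, IsVisited, mult_none_self_iff,
    ← rightCoset_eq_iff_mul_inv_mem, cosetMul_rightCoset]
  rw [eq_comm (a := rightCoset _ (_ * _))]

/-- `us` lists words that represent the cosets at the vertices `0, …, n` of `c`, and this
identification makes `c` the Stallings graph `Γ_L(H)`, where `H` is generated by `hs`: the vertices
are distinct cosets, the edges are edges of `Γ_L(H)`, every vertex but the root is on an edge, and
the table `T`, all of whose entries come from edges of `c`, reads all words of `L` with value
in `H` as loops at `1`. -/
structure IsStallingsCode (μ : FreeGroup (Fin r) →* G) (L : Language (Letter (Fin r)))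
    (hs : List (Word (Fin r))) (c : GraphCode r) (us : List (Word (Fin r)))
    (T : Table (Word (Fin r)) (Letter (Fin r))) : Prop where
  root : us.getD 0 [] = []
  distinct : ∀ i ∈ List.range (c.1 + 1), ∀ j ∈ List.range (c.1 + 1), i = j ∨
    HasNotMemWitness μ L hs (us.getD i [] ++ FreeGroup.invRev (us.getD j []))
  edge : ∀ t ∈ c.2, t.1 ≤ c.1 ∧ t.2.2 ≤ c.1 ∧
    HasEdgeWitness μ L hs (us.getD t.1 []) t.2.1 (us.getD t.2.2 [])
  incident : ∀ i ∈ List.range (c.1 + 1), i = 0 ∨ ∃ t, t ∈ c.2 ∧ (t.1 = i ∨ t.2.2 = i)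
  loops : HasLoopsWitness μ L hs T
  entry : ∀ e ∈ T, ∃ t, t ∈ c.2 ∧
    (e = ((us.getD t.1 [], (t.2.1, true)), us.getD t.2.2 []) ∨
      e = ((us.getD t.2.2 [], (t.2.1, false)), us.getD t.1 []))

/-- The isomorphism sends the vertex `i` to the coset of the `i`-th word of the list `us`. -/
theorem IsStallingsCode.iso (hL : IsAutomaticStructure μ L) {hs : List (Word (Fin r))}
    {c : GraphCode r} {us : List (Word (Fin r))} {T : Table (Word (Fin r)) (Letter (Fin r))}
    (hc : IsStallingsCode μ L hs c us T) :
    (GraphCode.graph c).Iso (stallingsGraph μ L (subgroupOf μ hs)) := by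
  set H := subgroupOf μ hs with hH
  let γ : ℕ → Quotient (QuotientGroup.rightRel H) := fun i => rightCoset H (wordVal μ (us.getD i []))
  have hroot : γ 0 = rightCoset H 1 := by
    change rightCoset H (wordVal μ (us.getD 0 [])) = _
    rw [hc.root, wordVal_nil]
  have hinj : Set.InjOn γ {i | i ≤ c.1} := by
    intro i hi j hj hij
    refine (hc.distinct i (List.mem_range.2 (Nat.lt_succ_of_le hi)) j
      (List.mem_range.2 (Nat.lt_succ_of_le hj))).resolve_right fun h => h.notMem hL ?_
    rw [wordVal_append, wordVal_invRev]
    exact rightCoset_eq_iff_mul_inv_mem.1 hij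
  have hedge : ∀ t ∈ c.2, t.1 ≤ c.1 ∧ t.2.2 ≤ c.1 ∧
      (stallingsGraph μ L H).edge (γ t.1) t.2.1 (γ t.2.2) := fun t ht =>
    ⟨(hc.edge t ht).1, (hc.edge t ht).2.1, hasEdgeWitness_iff.1 (hc.edge t ht).2.2⟩
  have hmul : ∀ t ∈ c.2, γ t.2.2 = cosetMul μ H (γ t.1) (t.2.1, true) := fun t ht =>
    (stallingsGraph_edge_iff.1 (hedge t ht).2.2).1
  have hvalid : IsValidTable μ H T := by
    rw [isValidTable_iff]
    intro e he
    obtain ⟨t, ht, rfl | rfl⟩ := hc.entry e he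
    · rw [← cosetMul_rightCoset]
      exact (hmul t ht).symm
    · rw [← cosetMul_rightCoset]
      exact (cosetMul_true_false_iff.2 (hmul t ht)).symm
  -- a letter read by a word of `L` with value in `H` is also read by the table
  have hread : ∀ u x v, u ++ x :: v ∈ L → wordVal μ (u ++ x :: v) ∈ H → ∃ m m',
      ((m, x), m') ∈ T ∧ rightCoset H (wordVal μ m) = rightCoset H (wordVal μ u) := by
    intro u x v hwL hw
    obtain ⟨m, hm, hv⟩ := Table.exists_run_of_run_append (hc.loops.run_eq hL hwL hw)
    obtain ⟨m', hm', -⟩ := Table.exists_move_of_run_cons hv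
    exact ⟨m, m', Table.mem_of_move hm', by simpa using hvalid.rightCoset_run hm⟩
  have hcover : ∀ p a q, (stallingsGraph μ L H).edge p a q →
      ∃ t ∈ c.2, t.2.1 = a ∧ γ t.1 = p ∧ γ t.2.2 = q := by
    intro p a q he
    obtain ⟨hq, u, v, ⟨hwL, hw, hu⟩ | ⟨hwL, hw, hu⟩⟩ := stallingsGraph_edge_iff.1 he
    · obtain ⟨m, m', hT, hm⟩ := hread _ _ _ hwL hw
      obtain ⟨t, ht, h | h⟩ := hc.entry _ hT
      · simp only [Prod.mk.injEq, and_true] at h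
        obtain ⟨⟨rfl, rfl⟩, rfl⟩ := h
        have hp : γ t.1 = p := hm.trans hu.symm
        exact ⟨t, ht, rfl, hp, by rw [hmul t ht, hp, hq]⟩
      · simp at h
    · obtain ⟨m, m', hT, hm⟩ := hread _ _ _ hwL hw
      obtain ⟨t, ht, h | h⟩ := hc.entry _ hT
      · simp at h
      · simp only [Prod.mk.injEq, and_true] at h
        obtain ⟨⟨rfl, rfl⟩, rfl⟩ := h
        have hq' : γ t.2.2 = q := hm.trans hu.symm
        refine ⟨t, ht, rfl, ?_, hq'⟩
        rw [cosetMul_true_false_iff.2 (hmul t ht), hq', cosetMul_true_false_iff.2 hq]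
  refine RootedGraph.iso_of_bijOn γ ⟨fun i hi => ?_, hinj, fun p hp => ?_⟩ hroot ?_
  · rw [mem_stallingsGraph_verts_iff]
    rcases hc.incident i (List.mem_range.2 (Nat.lt_succ_of_le hi)) with rfl | ⟨t, ht, rfl | rfl⟩
    · exact .inl hroot
    · exact .inr ⟨_, _, .inl (hedge t ht).2.2⟩
    · exact .inr ⟨_, _, .inr (hedge t ht).2.2⟩
  · rcases mem_stallingsGraph_verts_iff.1 hp with rfl | ⟨a, q, h | h⟩
    · exact ⟨0, Nat.zero_le _, hroot⟩
    · obtain ⟨t, ht, -, h1, -⟩ := hcover _ _ _ h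
      exact ⟨_, (hedge t ht).1, h1⟩
    · obtain ⟨t, ht, -, -, h1⟩ := hcover _ _ _ h
      exact ⟨_, (hedge t ht).2.1, h1⟩
  · intro i hi j hj a
    constructor
    · rintro ⟨h, -, -⟩
      exact (hedge _ h).2.2
    · intro h
      obtain ⟨⟨i', a', j'⟩, ht, rfl, h1, h2⟩ := hcover _ _ _ h
      have hb := hedge _ ht
      obtain rfl := hinj hb.1 hi h1
      obtain rfl := hinj hb.2.1 hj h2
      exact ⟨ht, hi, hj⟩

/-- The Stallings graph of a quasi-convex subgroup is finite, so it has a code. -/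
theorem IsQuasiConvex.exists_isStallingsCode (hμ : Function.Surjective μ)
    (hL : IsAutomaticStructure μ L) {hs : List (Word (Fin r))}
    (hH : IsQuasiConvex μ L (subgroupOf μ hs : Set G)) : ∃ c us T, IsStallingsCode μ L hs c us T := by
  classical
  set H := subgroupOf μ hs with hHdef
  set Γ := stallingsGraph μ L H with hΓ
  obtain ⟨ρ, hρ⟩ := exists_isCosetRep hμ H
  have hfin : Γ.verts.Finite := hH.finite_stallingsGraph_verts hμ
  -- an enumeration of the vertices that starts with the root
  obtain ⟨n, γ, hγ0, hinj, hγ⟩ : ∃ (n : ℕ) (γ : ℕ → Quotient (QuotientGroup.rightRel H)),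
      γ 0 = rightCoset H 1 ∧ Set.InjOn γ {i | i ≤ n} ∧ ∀ p, p ∈ Γ.verts ↔ ∃ i ≤ n, γ i = p := by
    have hl := Finset.nodup_toList (hfin.toFinset.erase (rightCoset H 1))
    have hmem : ∀ p, p ∈ (hfin.toFinset.erase (rightCoset H 1)).toList ↔
        p ≠ rightCoset H 1 ∧ p ∈ Γ.verts := by simp
    generalize (hfin.toFinset.erase (rightCoset H 1)).toList = l at hl hmem
    have hnd : (rightCoset H 1 :: l).Nodup :=
      List.nodup_cons.2 ⟨fun h => ((hmem _).1 h).1 rfl, hl⟩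
    refine ⟨l.length, fun i => (rightCoset H 1 :: l).getD i (rightCoset H 1), rfl, ?_, fun p => ?_⟩
    · intro i hi j hj hij
      have hi' : i < (rightCoset H 1 :: l).length := Nat.lt_succ_of_le hi
      have hj' : j < (rightCoset H 1 :: l).length := Nat.lt_succ_of_le hj
      beta_reduce at hij
      rw [List.getD_eq_getElem _ _ hi', List.getD_eq_getElem _ _ hj'] at hij
      exact (hnd.getElem_inj_iff).1 hij
    · have : p ∈ Γ.verts ↔ p ∈ rightCoset H 1 :: l := by
        rw [List.mem_cons, hmem]
        by_cases h : p = rightCoset H 1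
        · exact iff_of_true (h ▸ Γ.root_mem) (.inl h)
        · simp [h]
      rw [this, List.mem_iff_getElem]
      constructor
      · rintro ⟨i, hi, rfl⟩
        exact ⟨i, Nat.lt_succ_iff.1 hi, List.getD_eq_getElem _ _ hi⟩
      · rintro ⟨i, hi, rfl⟩
        exact ⟨i, Nat.lt_succ_of_le hi, (List.getD_eq_getElem _ _ _).symm⟩
  have hE : {t : ℕ × Fin r × ℕ | t.1 ≤ n ∧ t.2.2 ≤ n ∧ Γ.edge (γ t.1) t.2.1 (γ t.2.2)}.Finite :=
    ((Set.finite_Iic n).prod (Set.finite_univ.prod (Set.finite_Iic n))).subset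
      fun t ht => ⟨ht.1, trivial, ht.2.1⟩
  obtain ⟨T, hT⟩ := Table.exists_isTableOf (cosetMul μ H) ρ
    (F := {y | Γ.Step y.1 y.2 (cosetMul μ H y.1 y.2)})
    ((hfin.prod Set.finite_univ).subset fun y hy => ⟨by
      rcases hy with ⟨-, h⟩ | ⟨-, h⟩
      · exact Γ.edge_src h
      · exact Γ.edge_tgt h, trivial⟩)
  let us := (List.range (n + 1)).map fun i => ρ (γ i)
  have hus : ∀ i ≤ n, us.getD i [] = ρ (γ i) := fun i hi => by
    simp [us, List.getD_eq_getElem?_getD, Nat.lt_succ_of_le hi]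
  have hval : ∀ i ≤ n, rightCoset H (wordVal μ (us.getD i [])) = γ i := fun i hi => by
    rw [hus i hi, hρ.1]
  have hedge : ∀ p a q, Γ.edge p a q → ∃ t, t ∈ hE.toFinset.toList ∧ t.2.1 = a ∧
      t.1 ≤ n ∧ t.2.2 ≤ n ∧ γ t.1 = p ∧ γ t.2.2 = q := by
    intro p a q h
    obtain ⟨i, hi, rfl⟩ := (hγ p).1 (Γ.edge_src h)
    obtain ⟨j, hj, rfl⟩ := (hγ q).1 (Γ.edge_tgt h)
    exact ⟨(i, a, j), by simpa using ⟨hi, hj, h⟩, rfl, hi, hj, rfl, rfl⟩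
  refine ⟨(n, hE.toFinset.toList), us, T, ?_, ?_, ?_, ?_, ?_, ?_⟩
  · rw [hus 0 (Nat.zero_le _), hγ0, hρ.root]
  · intro i hi j hj
    rw [List.mem_range, Nat.lt_succ_iff] at hi hj
    by_cases hij : i = j
    · exact .inl hij
    · rw [hasNotMemWitness_iff hμ hL hH, wordVal_append, wordVal_invRev,
        ← rightCoset_eq_iff_mul_inv_mem, hval i hi, hval j hj]
      exact .inr fun h => hij (hinj hi hj h)
  · intro t ht
    simp only [Finset.mem_toList, Set.Finite.mem_toFinset, Set.mem_ofPred_eq] at ht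
    refine ⟨ht.1, ht.2.1, hasEdgeWitness_iff.2 ?_⟩
    rw [hval _ ht.1, hval _ ht.2.1]
    exact ht.2.2
  · intro i hi
    rw [List.mem_range, Nat.lt_succ_iff] at hi
    rcases mem_stallingsGraph_verts_iff.1 ((hγ _).2 ⟨i, hi, rfl⟩) with h | ⟨a, q, h | h⟩
    · exact .inl (hinj hi (Nat.zero_le n) (h.trans hγ0.symm))
    · obtain ⟨t, ht, -, hti, -, h1, -⟩ := hedge _ _ _ h
      exact .inr ⟨t, ht, .inl (hinj hti hi h1)⟩
    · obtain ⟨t, ht, -, -, hti, -, h1⟩ := hedge _ _ _ h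
      exact .inr ⟨t, ht, .inr (hinj hti hi h1)⟩
  · refine hasLoopsWitness_of_forall hμ hL hH fun w hwL hw => ?_
    rw [← hρ.root, hT.run_eq hρ.injective, foldl_cosetMul, one_mul, rightCoset_eq_one_iff.2 hw]
    rintro u b v rfl
    rw [foldl_cosetMul, one_mul]
    exact stallingsGraph_edge_of_mem hwL hw
  · rintro ⟨⟨p, ⟨a, b⟩⟩, q⟩ he
    obtain ⟨y, hy, rfl, rfl⟩ := (hT _ _ _).1 he
    rcases hy with ⟨h, h'⟩ | ⟨h, h'⟩
    · obtain rfl : b = true := h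
      obtain ⟨t, ht, rfl, h1, h2, h3, h4⟩ := hedge _ _ _ h'
      refine ⟨t, ht, .inl ?_⟩
      rw [hus _ h1, hus _ h2, h3, h4]
    · obtain rfl : b = false := h
      obtain ⟨t, ht, rfl, h1, h2, h3, h4⟩ := hedge _ _ _ h'
      refine ⟨t, ht, .inr ?_⟩
      rw [hus _ h1, hus _ h2, h3, h4]

attribute [local fun_prop] Primrec
attribute [local fun_prop] Primrec.id Primrec.const Primrec.comp Primrec.pair Primrec.fst Primrec.snd
attribute [local fun_prop] primrec_invRev primrec_append primrec_cons

@[local fun_prop]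
theorem primrec_getD_nil {α : Type*} [Primcodable α] {us : α → List (Word (Fin r))} {i : α → ℕ}
    (hus : Primrec us) (hi : Primrec i) : Primrec fun x => (us x).getD (i x) [] :=
  (Primrec.list_getD []).comp hus hi

@[local fun_prop]
theorem primrec_range_succ {α : Type*} [Primcodable α] {n : α → ℕ} (hn : Primrec n) :
    Primrec fun x => List.range (n x + 1) :=
  Primrec.list_range.comp (Primrec.succ.comp hn)

theorem IsAutomaticStructure.sigmaOne_isStallingsCode (hL : IsAutomaticStructure μ L) :
    SigmaOne fun x : List (Word (Fin r)) × GraphCode r => ∃ us T,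
      IsStallingsCode μ L x.1 x.2 us T := by
  have key : SigmaOne fun x : List (Word (Fin r)) × GraphCode r =>
      ∃ (us : List (Word (Fin r))) (T : Table (Word (Fin r)) (Letter (Fin r))),
        us.getD 0 [] = [] ∧
        (∀ i ∈ List.range (x.2.1 + 1), ∀ j ∈ List.range (x.2.1 + 1), i = j ∨
          HasNotMemWitness μ L x.1 (us.getD i [] ++ FreeGroup.invRev (us.getD j []))) ∧
        (∀ t ∈ x.2.2, t.1 ≤ x.2.1 ∧ t.2.2 ≤ x.2.1 ∧
          HasEdgeWitness μ L x.1 (us.getD t.1 []) t.2.1 (us.getD t.2.2 [])) ∧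
        (∀ i ∈ List.range (x.2.1 + 1), i = 0 ∨ ∃ t, t ∈ x.2.2 ∧ (t.1 = i ∨ t.2.2 = i)) ∧
        HasLoopsWitness μ L x.1 T ∧
        ∀ e ∈ T, ∃ t, t ∈ x.2.2 ∧
          (e = ((us.getD t.1 [], (t.2.1, true)), us.getD t.2.2 []) ∨
            e = ((us.getD t.2.2 [], (t.2.1, false)), us.getD t.1 [])) := by
    refine .ex (.ex (.and (.eq ?_ ?_) (.and (.forall_mem (.forall_mem (.or (.eq ?_ ?_)
      (hL.sigmaOne_hasNotMemWitness ?_ ?_)) ?_) ?_) (.and (.forall_mem (.and (.le ?_ ?_)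
      (.and (.le ?_ ?_) (.and (hL.sigmaOne_mem_subgroupOf ?_ ?_) (.ex (.ex (.or
        (.and (hL.sigmaOne_mult ?_ ?_ ?_) (.and (hL.sigmaOne_mem_subgroupOf ?_ ?_)
          (hL.sigmaOne_mem_subgroupOf ?_ ?_)))
        (.and (hL.sigmaOne_mult ?_ ?_ ?_) (.and (hL.sigmaOne_mem_subgroupOf ?_ ?_)
          (hL.sigmaOne_mem_subgroupOf ?_ ?_))))))))) ?_)
      (.and (.forall_mem (.or (.eq ?_ ?_) (.ex (.and (.mem ?_ ?_) (.or (.eq ?_ ?_) (.eq ?_ ?_))))) ?_)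
      (.and (hL.sigmaOne_hasLoopsWitness ?_ ?_)
      (.forall_mem (.ex (.and (.mem ?_ ?_) (.or (.eq ?_ ?_) (.eq ?_ ?_)))) ?_)))))))
    all_goals fun_prop
  refine key.of_iff fun x => exists_congr fun us => exists_congr fun T => ?_
  exact ⟨fun h => ⟨h.1, h.2, h.3, h.4, h.5, h.6⟩, fun ⟨h1, h2, h3, h4, h5, h6⟩ =>
    ⟨h1, h2, h3, h4, h5, h6⟩⟩

theorem exists_partrec_stallingsGraph (hμ : Function.Surjective μ)
    (hL : IsAutomaticStructure μ L) :
    ∃ stallings : List (Word (Fin r)) →. GraphCode r, Partrec stallings ∧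
      ∀ hs, IsQuasiConvex μ L (subgroupOf μ hs : Set G) →
        ∃ c ∈ stallings hs, (GraphCode.graph c).Iso (stallingsGraph μ L (subgroupOf μ hs)) := by
  obtain ⟨f, hf, h1, h2⟩ := SigmaOne.exists_partrec
    (p := fun hs c => ∃ us T, IsStallingsCode μ L hs c us T) hL.sigmaOne_isStallingsCode
  refine ⟨f, hf, fun hs hH => ?_⟩
  have hdom := h2 hs (hH.exists_isStallingsCode hμ hL)
  obtain ⟨us, T, h⟩ := h1 _ _ (Part.get_mem hdom)
  exact ⟨_, Part.get_mem hdom, h.iso hL⟩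

end Compute

theorem mainTheorem1 {G : Type*} [Group G] (r : ℕ) (μ : FreeGroup (Fin r) →* G)
    (hμ : Function.Surjective μ) (L : Language (Letter (Fin r)))
    (hL : IsAutomaticStructure μ L) :
    -- one algorithm computes the Stallings graph from a list of generators
    (∃ stallings : List (Word (Fin r)) →. GraphCode r, Partrec stallings ∧
      ∀ hs, IsQuasiConvex μ L (subgroupOf μ hs : Set G) →
        ∃ c ∈ stallings hs, (GraphCode.graph c).Iso (stallingsGraph μ L (subgroupOf μ hs))) ∧
    -- one algorithm decides membership from a list of generators and a word
    (∃ member : List (Word (Fin r)) × Word (Fin r) →. Bool, Partrec member ∧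
      ∀ hs, IsQuasiConvex μ L (subgroupOf μ hs : Set G) →
        ∀ w, ∃ b ∈ member (hs, w), (b = true ↔ wordVal μ w ∈ subgroupOf μ hs)) ∧
    -- membership is decidable for each quasi-convex subgroup
    (∀ H : Subgroup G, IsQuasiConvex μ L (H : Set G) →
      ComputablePred fun w : Word (Fin r) => wordVal μ w ∈ H) ∧
    -- one algorithm computes the least constant of quasi-convexity from a list of generators
    (∃ const : List (Word (Fin r)) →. ℕ, Partrec const ∧
      ∀ hs, IsQuasiConvex μ L (subgroupOf μ hs : Set G) →
        ∃ k ∈ const hs, IsLeast {k | IsQuasiConvexConst μ L (subgroupOf μ hs : Set G) k} k) :=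
  ⟨exists_partrec_stallingsGraph hμ hL, exists_partrec_mem hμ hL,
    fun _ hH => computablePred_mem_of_isQuasiConvex hμ hL hH, exists_partrec_isLeast_const hμ hL⟩
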